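/- Let $\mathcal L=\mathcal L_{\bar 0}\oplus\mathcal L_{\bar 1}$ be the Ramond $N=2$ superconformal algebra: the complex Lie superalgebra with basis $L_i,H_i,c$ (even) and $G_i^+,G_i^-$ (odd), $i\in\mathbb Z$, where $c$ is central and $$[L_i,L_j]=(i-j)L_{i+j}+\tfrac1{12}(i^3-i)\delta_{i+j,0}c,\quad [L_i,H_j]=-jH_{i+j},\quad [H_i,H_j]=\tfrac13 i\,\delta_{i+j,0}c,$$ $$[L_i,G_j^\pm]=(\tfrac i2-j)G_{i+j}^\pm,\quad [H_i,G_j^\pm]=\pm G_{i+j}^\pm,\quad [G_i^+,G_j^+]=[G_i^-,G_j^-]=0,$$ $$[G_i^-,G_j^+]=2L_{i+j}-(i-j)H_{i+j}+\tfrac13(i^2-\tfrac14)\delta_{i+j,0}c .$$ Put $\mathcal H=\mathbb CL_0+\mathbb CH_0+\mathbb Cc$. A ($\mathbb Z/2$-graded) $\mathcal L$-module $V=V_0\oplus V_1$ is a Harish-Chandra module if it is the direct sum of its weight spaces $V^\lambda$, $\lambda\in\mathcal H^*$, and these are finite-dimensional. A module of the intermediate series is an indecomposable Harish-Chandra module $V=V_0\oplus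 V_1$ such that, for each $p\in\{0,1\}$ and $\mu\in\mathbb C$, the space $V_p^{\mu}=\{v\in V_p: L_0v=\mu v\}$ has dimension at most one. **Theorem.** Every module of the intermediate series over $\mathcal L$ is isomorphic, up to a reversal of parity, to one of the following modules or to a quotient of one of them, for some $a,b,\alpha,\beta\in\mathbb C$. Each of them has a basis $\{x_j,y_j: j\in\mathbb Z\}$ with $x_j$ even and $y_j$ odd, $c$ acts by $0$, and for $i,j\in\mathbb Z$: * $RA_{a,b}$: $L_ix_j=(a-j+ib)x_{i+j}$, $L_iy_j=(a-j+i(b+\frac12))y_{i+j}$, $H_ix_j=-(2b+2)x_{i+j}$, $H_iy_j=-(2b+1)y_{i+j}$, $G_i^-x_j=G_i^+y_j=0$, $G_i^+x_j=y_{i+j}$, $G_i^-y_j=2(a+i-j+2ib)x_{i+j}$. * $RB_{a,b}$: $L_ix_j=(a-j+ib)x_{i+j}$, $L_iy_j=(a-j+i(b+\frac12))y_{i+j}$, $H_ix_j=(2b+2)x_{i+j}$, $H_iy_j=(2b+1)y_{i+j}$, $G_i^+x_j=G_i^-y_j=0$, $G_i^-x_j=y_{i+j}$, $G_i^+y_j=2(a+i-j+2ib)x_{i+j}$.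 * $RA_\alpha$ ($k\ne0$): $L_ix_k=-(i+k)x_{i+k}$, $L_ix_0=(i\alpha+\frac{i^2}2)x_i$, $L_iy_j=-(\frac i2+j)y_{i+j}$, $H_iy_j=y_{i+j}$, $H_ix_k=0$, $H_ix_0=ix_i$, $G_i^-x_j=G_i^+y_j=0$, $G_i^-y_j=-2(i+j)x_{i+j}$, $G_i^+x_k=y_{i+k}$, $G_i^+x_0=-(\alpha+i)y_i$. * $RA^\beta$ ($k\ne-i$): $L_ix_j=-(\frac i2+j)x_{i+j}$, $L_iy_k=-ky_{i+k}$, $L_iy_{-i}=(i\beta+\frac{i^2}2)y_0$, $H_ix_j=-x_{i+j}$, $H_iy_k=0$, $H_iy_{-i}=iy_0$, $G_i^-x_j=G_i^+y_j=0$, $G_i^+x_k=y_{i+k}$, $G_i^+x_{-i}=(\beta+i)y_0$, $G_i^-y_j=-2jx_{i+j}$. * $RB_\alpha$ ($k\ne0$): $L_ix_k=-(i+k)x_{i+k}$, $L_ix_0=-(i\alpha+\frac{i^2}2)x_i$, $L_iy_j=-(\frac i2+j)y_{i+j}$, $H_iy_j=-y_{i+j}$, $H_ix_k=0$, $H_ix_0=ix_i$,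 $G_i^+x_j=G_i^-y_j=0$, $G_i^+y_j=-2(i+j)x_{i+j}$, $G_i^-x_k=y_{i+k}$, $G_i^-x_0=(\alpha+i)y_i$. * $RB^\beta$ ($k\ne-i$): $L_ix_j=-(\frac i2+j)x_{i+j}$, $L_iy_k=-ky_{i+k}$, $L_iy_{-i}=-(i\beta+\frac{i^2}2)y_0$, $H_ix_j=x_{i+j}$, $H_iy_k=0$, $H_iy_{-i}=iy_0$, $G_i^+x_j=G_i^-y_j=0$, $G_i^-x_k=y_{i+k}$, $G_i^-x_{-i}=-(\beta+i)y_0$, $G_i^+y_j=-2jx_{i+j}$. -/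

import Mathlib

set_option linter.unusedSimpArgs false

noncomputable section

open Finsupp

/-! ### Lie superalgebras and their modules -/

/-- The sign `(-1)^{a b}` for parities `a, b ∈ ℤ/2`. -/
def koszulSign (a b : ZMod 2) : ℂ := if a = 1 ∧ b = 1 then -1 else 1

/-- A complex Lie superalgebra structure on the vector space `𝔤`. -/
structure LieSuperalgebra (𝔤 : Type*) [AddCommGroup 𝔤] [Module ℂ 𝔤] where
  /-- the even part `part 0` and the odd part `part 1` -/
  part : ZMod 2 → Submodule ℂ 𝔤
  isCompl : IsCompl (part 0) (part 1)
  /-- the superbracket -/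
  bracket : 𝔤 →ₗ[ℂ] 𝔤 →ₗ[ℂ] 𝔤
  bracket_mem : ∀ {a b : ZMod 2} {x y : 𝔤}, x ∈ part a → y ∈ part b → bracket x y ∈ part (a + b)
  super_skew : ∀ {a b : ZMod 2} {x y : 𝔤}, x ∈ part a → y ∈ part b →
    bracket x y = -(koszulSign a b • bracket y x)
  super_jacobi : ∀ {a b : ZMod 2} {x y : 𝔤} (z : 𝔤), x ∈ part a → y ∈ part b →
    bracket x (bracket y z) = bracket (bracket x y) z + koszulSign a b • bracket y (bracket x z)

/-- A (`ℤ/2`-graded) module structure over the Lie superalgebra `A` on the vector space `V`. -/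
structure LieSuperalgebra.SuperModule {𝔤 : Type*} [AddCommGroup 𝔤] [Module ℂ 𝔤]
    (A : LieSuperalgebra 𝔤) (V : Type*) [AddCommGroup V] [Module ℂ V] where
  /-- `V = V₀ ⊕ V₁` -/
  part : ZMod 2 → Submodule ℂ V
  isCompl : IsCompl (part 0) (part 1)
  /-- the action of `𝔤` -/
  act : 𝔤 →ₗ[ℂ] Module.End ℂ V
  act_mem : ∀ {a b : ZMod 2} {x : 𝔤} {v : V}, x ∈ A.part a → v ∈ part b → act x v ∈ part (a + b)
  act_bracket : ∀ {a b : ZMod 2} {x y : 𝔤}, x ∈ A.part a → y ∈ A.part b →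
    act (A.bracket x y) = act x * act y - koszulSign a b • (act y * act x)

namespace LieSuperalgebra.SuperModule

variable {𝔤 : Type*} [AddCommGroup 𝔤] [Module ℂ 𝔤] {A : LieSuperalgebra 𝔤}
  {V : Type*} [AddCommGroup V] [Module ℂ V] {W : Type*} [AddCommGroup W] [Module ℂ W]

/-- `S` is a (graded) submodule: stable under the action, and the sum of its even and odd parts. -/
def IsSubmodule (M : A.SuperModule V) (S : Submodule ℂ V) : Prop :=
  (∀ x : 𝔤, ∀ v ∈ S, M.act x v ∈ S) ∧ S = (S ⊓ M.part 0) ⊔ (S ⊓ M.part 1)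

/-- `V` is nonzero and is not the direct sum of two nonzero submodules. -/
def IsIndecomposable (M : A.SuperModule V) : Prop :=
  Nontrivial V ∧ ∀ S T : Submodule ℂ V, M.IsSubmodule S → M.IsSubmodule T → IsCompl S T →
    S = ⊥ ∨ T = ⊥

/-- `N` is isomorphic, up to a reversal of parity, to a quotient of `M` by a submodule (possibly by
the zero submodule): there is a surjective homogeneous `𝔤`-module homomorphism from `M` to `N`. -/
def IsQuotientOf (N : A.SuperModule W) (M : A.SuperModule V) : Prop :=
  ∃ f : V →ₗ[ℂ] W, Function.Surjective f ∧ (∀ x v, f (M.act x v) = N.act x (f v)) ∧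
    ∃ e : ZMod 2, ∀ a : ZMod 2, ∀ v ∈ M.part a, f v ∈ N.part (a + e)

end LieSuperalgebra.SuperModule

/-! ### The Ramond `N = 2` superconformal algebra -/

/-- The standard basis `L_i, H_i, G_i^+, G_i^-` (`i ∈ ℤ`), `c`. -/
inductive RamondBasis : Type
  | L (i : ℤ)
  | H (i : ℤ)
  | Gp (i : ℤ)
  | Gm (i : ℤ)
  | C

namespace RamondBasis

/-- Parity of the basis elements: `L_i, H_i, c` are even, `G_i^+, G_i^-` are odd. -/
def parity : RamondBasis → ZMod 2
  | L _ => 0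
  | H _ => 0
  | Gp _ => 1
  | Gm _ => 1
  | C => 0

end RamondBasis

/-- The underlying vector space of the Ramond `N = 2` superconformal algebra. -/
abbrev RamondSpace : Type := RamondBasis →₀ ℂ

namespace Ramond

/-- `L_i` -/
def L (i : ℤ) : RamondSpace := single (RamondBasis.L i) 1
/-- `H_i` -/
def H (i : ℤ) : RamondSpace := single (RamondBasis.H i) 1
/-- `G_i^+` -/
def Gp (i : ℤ) : RamondSpace := single (RamondBasis.Gp i) 1
/-- `G_i^-` -/
def Gm (i : ℤ) : RamondSpace := single (RamondBasis.Gm i) 1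
/-- the central element `c` -/
def C : RamondSpace := single RamondBasis.C 1

/-- Kronecker's `δ_{n,0}` -/
def δ (n : ℤ) : ℂ := if n = 0 then 1 else 0

/-- The superbracket on basis elements. -/
def bracketBasis : RamondBasis → RamondBasis → RamondSpace
  | .L i, .L j => ((i : ℂ) - j) • L (i + j) + ((1 / 12 : ℂ) * ((i : ℂ) ^ 3 - i) * δ (i + j)) • C
  | .L i, .H j => (-(j : ℂ)) • H (i + j)
  | .H i, .L j => (i : ℂ) • H (i + j)
  | .H i, .H j => ((1 / 3 : ℂ) * i * δ (i + j)) • C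
  | .L i, .Gp j => ((i : ℂ) / 2 - j) • Gp (i + j)
  | .Gp i, .L j => (-((j : ℂ) / 2 - i)) • Gp (i + j)
  | .L i, .Gm j => ((i : ℂ) / 2 - j) • Gm (i + j)
  | .Gm i, .L j => (-((j : ℂ) / 2 - i)) • Gm (i + j)
  | .H i, .Gp j => Gp (i + j)
  | .Gp i, .H j => -Gp (i + j)
  | .H i, .Gm j => -Gm (i + j)
  | .Gm i, .H j => Gm (i + j)
  | .Gp _, .Gp _ => 0
  | .Gm _, .Gm _ => 0
  | .Gm i, .Gp j => (2 : ℂ) • L (i + j) - ((i : ℂ) - j) • H (i + j)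
      + ((1 / 3 : ℂ) * ((i : ℂ) ^ 2 - 1 / 4) * δ (i + j)) • C
  | .Gp i, .Gm j => (2 : ℂ) • L (i + j) - ((j : ℂ) - i) • H (i + j)
      + ((1 / 3 : ℂ) * ((j : ℂ) ^ 2 - 1 / 4) * δ (i + j)) • C
  | .C, _ => 0
  | _, .C => 0

/-- The superbracket, extended bilinearly. -/
def bracket : RamondSpace →ₗ[ℂ] RamondSpace →ₗ[ℂ] RamondSpace :=
  linearCombination ℂ fun x => linearCombination ℂ fun y => bracketBasis x y

/-- The span of the basis vectors of parity `a`, for a basis indexed by `ι` with parities `p`. -/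
def homogeneous {ι : Type*} (p : ι → ZMod 2) (a : ZMod 2) : Submodule ℂ (ι →₀ ℂ) :=
  Finsupp.supported ℂ ℂ {i | p i = a}

theorem homogeneous_isCompl {ι : Type*} (p : ι → ZMod 2) :
    IsCompl (homogeneous p 0) (homogeneous p 1) := by
  have h : {i | p i = 1} = {i | p i = 0}ᶜ := by
    ext i
    have : ∀ a : ZMod 2, a = 1 ↔ ¬ a = 0 := by decide
    exact this _
  unfold homogeneous
  rw [h]
  refine ⟨?_, ?_⟩
  · rw [Finsupp.disjoint_supported_supported_iff]
    exact disjoint_compl_right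
  · exact Finsupp.codisjoint_supported_supported isCompl_compl.codisjoint

theorem single_mem {ι : Type*} (p : ι → ZMod 2) {a : ZMod 2} {i : ι} (h : p i = a) (r : ℂ) :
    single i r ∈ homogeneous p a :=
  Finsupp.single_mem_supported ℂ r h

theorem ext_homogeneous {ι : Type*} {p : ι → ZMod 2} {a : ZMod 2} {M : Type*} [AddCommGroup M]
    [Module ℂ M] {f g : (ι →₀ ℂ) →ₗ[ℂ] M}
    (h : ∀ i, p i = a → f (single i 1) = g (single i 1)) {x : ι →₀ ℂ}
    (hx : x ∈ homogeneous p a) : f x = g x := by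
  rw [homogeneous, Finsupp.supported_eq_span_single] at hx
  refine LinearMap.eqOn_span (R := ℂ) ?_ hx
  rintro _ ⟨i, hi, rfl⟩
  exact h i hi

theorem mem_homogeneous {ι : Type*} {p : ι → ZMod 2} {a : ZMod 2} {M : Type*} [AddCommGroup M]
    [Module ℂ M] {f : (ι →₀ ℂ) →ₗ[ℂ] M} {S : Submodule ℂ M}
    (h : ∀ i, p i = a → f (single i 1) ∈ S) {x : ι →₀ ℂ}
    (hx : x ∈ homogeneous p a) : f x ∈ S := by
  rw [homogeneous, Finsupp.supported_eq_span_single] at hx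
  have : Submodule.span ℂ ((fun i => single i (1 : ℂ)) '' {i | p i = a}) ≤ S.comap f := by
    rw [Submodule.span_le]
    rintro _ ⟨i, hi, rfl⟩
    exact h i hi
  exact this hx

theorem bracket_single (x y : RamondBasis) :
    bracket (single x 1) (single y 1) = bracketBasis x y := by
  simp [bracket]

theorem bracketBasis_mem (x y : RamondBasis) :
    bracketBasis x y ∈ homogeneous RamondBasis.parity (x.parity + y.parity) := by
  have hL : ∀ i, L i ∈ homogeneous RamondBasis.parity 0 := fun i => single_mem _ rfl _
  have hH : ∀ i, H i ∈ homogeneous RamondBasis.parity 0 := fun i => single_mem _ rfl _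
  have hP : ∀ i, Gp i ∈ homogeneous RamondBasis.parity 1 := fun i => single_mem _ rfl _
  have hM : ∀ i, Gm i ∈ homogeneous RamondBasis.parity 1 := fun i => single_mem _ rfl _
  have hC : C ∈ homogeneous RamondBasis.parity 0 := single_mem _ rfl _
  match x, y with
  | .L _, .L _ => exact Submodule.add_mem _ (Submodule.smul_mem _ _ (hL _)) (Submodule.smul_mem _ _ hC)
  | .L _, .H _ => exact Submodule.smul_mem _ _ (hH _)
  | .H _, .L _ => exact Submodule.smul_mem _ _ (hH _)
  | .H _, .H _ => exact Submodule.smul_mem _ _ hC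
  | .L _, .Gp _ => exact Submodule.smul_mem _ _ (hP _)
  | .Gp _, .L _ => exact Submodule.smul_mem _ _ (hP _)
  | .L _, .Gm _ => exact Submodule.smul_mem _ _ (hM _)
  | .Gm _, .L _ => exact Submodule.smul_mem _ _ (hM _)
  | .H _, .Gp _ => exact hP _
  | .Gp _, .H _ => exact Submodule.neg_mem _ (hP _)
  | .H _, .Gm _ => exact Submodule.neg_mem _ (hM _)
  | .Gm _, .H _ => exact hM _
  | .Gp _, .Gp _ => exact Submodule.zero_mem _
  | .Gm _, .Gm _ => exact Submodule.zero_mem _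
  | .Gm _, .Gp _ => exact Submodule.add_mem _ (Submodule.sub_mem _ (Submodule.smul_mem _ _ (hL _))
        (Submodule.smul_mem _ _ (hH _))) (Submodule.smul_mem _ _ hC)
  | .Gp _, .Gm _ => exact Submodule.add_mem _ (Submodule.sub_mem _ (Submodule.smul_mem _ _ (hL _))
        (Submodule.smul_mem _ _ (hH _))) (Submodule.smul_mem _ _ hC)
  | .C, _ => exact Submodule.zero_mem _
  | .L _, .C => exact Submodule.zero_mem _
  | .H _, .C => exact Submodule.zero_mem _
  | .Gp _, .C => exact Submodule.zero_mem _
  | .Gm _, .C => exact Submodule.zero_mem _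

theorem δ_cases (n : ℤ) : n = 0 ∧ δ n = 1 ∨ δ n = 0 := by
  by_cases h : n = 0 <;> simp [δ, h]

theorem bracketBasis_skew (x y : RamondBasis) :
    bracketBasis x y = -(koszulSign x.parity y.parity • bracketBasis y x) := by
  have h01 : ¬ (0 : ZMod 2) = 1 := by decide
  cases x <;> cases y <;> simp only [bracketBasis, RamondBasis.parity, koszulSign, h01,
    and_self, and_false, false_and, if_true, if_false]
  case L.L i j =>
    rw [add_comm j i]
    rcases δ_cases (i + j) with ⟨h, h'⟩ | h'
    · have hj : j = -i := by omega
      rw [h']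
      subst hj
      push_cast
      module
    · rw [h']
      module
  case H.H i j =>
    rw [add_comm j i]
    rcases δ_cases (i + j) with ⟨h, h'⟩ | h'
    · have hj : j = -i := by omega
      rw [h']
      subst hj
      push_cast
      module
    · rw [h']
      module
  case Gp.Gm i j =>
    rw [add_comm j i]
    module
  case Gm.Gp i j =>
    rw [add_comm j i]
    module
  case Gp.Gp => simp
  case Gm.Gm => simp
  all_goals first
    | (rw [add_comm]; module)
    | module

theorem bracketBasis_C (x : RamondBasis) : bracketBasis x .C = 0 := by
  cases x <;> rfl

theorem jacobiBasis (x y z : RamondBasis) :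
    bracket (single x 1) (bracketBasis y z) = bracket (bracketBasis x y) (single z 1)
      + koszulSign x.parity y.parity • bracket (single y 1) (bracketBasis x z) := by
  have h01 : ¬ (0 : ZMod 2) = 1 := by decide
  have eL : ∀ i, L i = single (RamondBasis.L i) 1 := fun _ => rfl
  have eH : ∀ i, H i = single (RamondBasis.H i) 1 := fun _ => rfl
  have eP : ∀ i, Gp i = single (RamondBasis.Gp i) 1 := fun _ => rfl
  have eM : ∀ i, Gm i = single (RamondBasis.Gm i) 1 := fun _ => rfl
  have eC : C = single RamondBasis.C 1 := rfl
  cases x <;> cases y <;> cases z <;> simp only [bracketBasis, RamondBasis.parity, koszulSign, h01,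
    and_self, and_false, false_and, if_true, if_false, map_add, map_sub, map_neg, map_smul,
    map_zero, LinearMap.add_apply, LinearMap.sub_apply, LinearMap.neg_apply, LinearMap.smul_apply,
    LinearMap.zero_apply, eL, eH, eP, eM, eC, bracket_single]
  all_goals try simp only [← eL, ← eH, ← eP, ← eM, ← eC, smul_zero, neg_zero, add_zero, sub_zero]
  all_goals
    rename_i i j k
    have e1 : j + (i + k) = i + (j + k) := by ring
    have e2 : i + j + k = i + (j + k) := by ring
    try simp only [e1, e2]
    all_goals first
    | (push_cast; module)
    | (rcases δ_cases (i + (j + k)) with ⟨h, h'⟩ | h'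
       · have hk : k = -i - j := by omega
         simp only [h']
         subst hk
         push_cast
         module
       · simp only [h']
         push_cast
         module)


/-- The Ramond `N = 2` superconformal algebra. -/
def algebra : LieSuperalgebra RamondSpace where
  part := homogeneous RamondBasis.parity
  isCompl := homogeneous_isCompl _
  bracket := bracket
  bracket_mem := by
    intro a b x y hx hy
    refine mem_homogeneous (f := bracket.flip y) (fun i hi => ?_) hx
    refine mem_homogeneous (f := bracket (single i 1)) (fun j hj => ?_) hy
    rw [bracket_single, ← hi, ← hj]
    exact bracketBasis_mem i j
  super_skew := by
    intro a b x y hx hy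
    refine ext_homogeneous (f := bracket.flip y) (g := -(koszulSign a b • bracket y))
      (fun i hi => ?_) hx
    refine ext_homogeneous (f := bracket (single i 1))
      (g := -(koszulSign a b • bracket.flip (single i 1))) (fun j hj => ?_) hy
    simp only [LinearMap.neg_apply, LinearMap.smul_apply, LinearMap.flip_apply, bracket_single]
    rw [← hi, ← hj]
    exact bracketBasis_skew i j
  super_jacobi := by
    intro a b x y z hx hy
    refine ext_homogeneous (f := bracket.flip (bracket y z))
      (g := bracket.flip z ∘ₗ bracket.flip y + koszulSign a b • (bracket y ∘ₗ bracket.flip z))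
      (fun i hi => ?_) hx
    refine ext_homogeneous (f := bracket (single i 1) ∘ₗ bracket.flip z)
      (g := bracket.flip z ∘ₗ bracket (single i 1)
        + koszulSign a b • bracket.flip (bracket (single i 1) z)) (fun j hj => ?_) hy
    have : bracket (single i 1) ∘ₗ bracket (single j 1) =
        bracket (bracket (single i 1) (single j 1))
          + koszulSign a b • (bracket (single j 1) ∘ₗ bracket (single i 1)) := by
      refine Finsupp.lhom_ext' fun k => LinearMap.ext_ring ?_
      simp only [LinearMap.comp_apply, LinearMap.add_apply, LinearMap.smul_apply,
        Finsupp.lsingle_apply, bracket_single]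
      rw [← hi, ← hj]
      exact jacobiBasis i j k
    exact LinearMap.congr_fun this z

/-- A module over the Ramond algebra with a homogeneous basis indexed by `ι` (with parities `p`), on
which the basis elements of the algebra act through `op`. -/
def moduleOfBasis {ι : Type*} (p : ι → ZMod 2) (op : RamondBasis → Module.End ℂ (ι →₀ ℂ))
    (hmem : ∀ x i, op x (single i 1) ∈ homogeneous p (x.parity + p i))
    (hop : ∀ x y, linearCombination ℂ op (bracketBasis x y) =
      op x * op y - koszulSign x.parity y.parity • (op y * op x)) :
    algebra.SuperModule (ι →₀ ℂ) where
  part := homogeneous p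
  isCompl := homogeneous_isCompl p
  act := linearCombination ℂ op
  act_mem := by
    intro a b x v hx hv
    refine mem_homogeneous (f := (linearCombination ℂ op).flip v) (fun i hi => ?_) hx
    simp only [LinearMap.flip_apply, linearCombination_single, one_smul]
    refine mem_homogeneous (f := op i) (fun j hj => ?_) hv
    rw [← hi, ← hj]
    exact hmem i j
  act_bracket := by
    intro a b x y hx hy
    refine LinearMap.ext fun v => ?_
    refine ext_homogeneous (f := (linearCombination ℂ op).flip v ∘ₗ bracket.flip y)
      (g := (linearCombination ℂ op).flip (linearCombination ℂ op y v) - koszulSign a b •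
        (linearCombination ℂ op y ∘ₗ (linearCombination ℂ op).flip v)) (fun i hi => ?_) hx
    refine ext_homogeneous (f := (linearCombination ℂ op).flip v ∘ₗ bracket (single i 1))
      (g := linearCombination ℂ op (single i 1) ∘ₗ (linearCombination ℂ op).flip v -
        koszulSign a b • (linearCombination ℂ op).flip (linearCombination ℂ op (single i 1) v))
      (fun j hj => ?_) hy
    simp only [LinearMap.comp_apply, LinearMap.sub_apply, LinearMap.smul_apply,
      LinearMap.flip_apply, bracket_single, linearCombination_single, one_smul]
    rw [← hi, ← hj, hop i j]
    rfl

/-- Structure coefficients of an action of the Ramond algebra on the space with basis `x_j, y_j`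
(`j ∈ ℤ`), with `x_j` even and `y_j` odd, such that `c` acts by zero and
`L_i x_j = Lx i j x_{i+j}`, `L_i y_j = Ly i j y_{i+j}`, `H_i x_j = Hx i j x_{i+j}`,
`H_i y_j = Hy i j y_{i+j}`, `G_i^+ x_j = Gpx i j y_{i+j}`, `G_i^+ y_j = Gpy i j x_{i+j}`,
`G_i^- x_j = Gmx i j y_{i+j}`, `G_i^- y_j = Gmy i j x_{i+j}`. -/
structure Coeffs where
  Lx : ℤ → ℤ → ℂ
  Ly : ℤ → ℤ → ℂ
  Hx : ℤ → ℤ → ℂ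
  Hy : ℤ → ℤ → ℂ
  Gpx : ℤ → ℤ → ℂ
  Gpy : ℤ → ℤ → ℂ
  Gmx : ℤ → ℤ → ℂ
  Gmy : ℤ → ℤ → ℂ

/-- The space with basis `x_j, y_j` (`j ∈ ℤ`). -/
abbrev XYSpace : Type := (ℤ ⊕ ℤ) →₀ ℂ

/-- The basis vector `x_j`. -/
def vx (j : ℤ) : XYSpace := single (Sum.inl j) 1
/-- The basis vector `y_j`. -/
def vy (j : ℤ) : XYSpace := single (Sum.inr j) 1

/-- `x_j` is even, `y_j` is odd. -/
def parityXY : ℤ ⊕ ℤ → ZMod 2 := Sum.elim (fun _ => 0) (fun _ => 1)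

/-- The linear map given by its values on the basis `x_j, y_j`. -/
def ofValues (u v : ℤ → XYSpace) : Module.End ℂ XYSpace := linearCombination ℂ (Sum.elim u v)

namespace Coeffs

/-- The operators by which the basis elements of the Ramond algebra act. -/
def op (K : Coeffs) : RamondBasis → Module.End ℂ XYSpace
  | .L i => ofValues (fun j => K.Lx i j • vx (i + j)) (fun j => K.Ly i j • vy (i + j))
  | .H i => ofValues (fun j => K.Hx i j • vx (i + j)) (fun j => K.Hy i j • vy (i + j))
  | .Gp i => ofValues (fun j => K.Gpx i j • vy (i + j)) (fun j => K.Gpy i j • vx (i + j))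
  | .Gm i => ofValues (fun j => K.Gmx i j • vy (i + j)) (fun j => K.Gmy i j • vx (i + j))
  | .C => 0

/-- The relations among the coefficients that make `op` a representation. -/
structure Relations (K : Coeffs) : Prop where
  LLx : ∀ i j k : ℤ, ((i : ℂ) - j) * K.Lx (i + j) k =
    K.Lx j k * K.Lx i (j + k) - K.Lx i k * K.Lx j (i + k)
  LLy : ∀ i j k : ℤ, ((i : ℂ) - j) * K.Ly (i + j) k =
    K.Ly j k * K.Ly i (j + k) - K.Ly i k * K.Ly j (i + k)
  LHx : ∀ i j k : ℤ, (-(j : ℂ)) * K.Hx (i + j) k =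
    K.Hx j k * K.Lx i (j + k) - K.Lx i k * K.Hx j (i + k)
  LHy : ∀ i j k : ℤ, (-(j : ℂ)) * K.Hy (i + j) k =
    K.Hy j k * K.Ly i (j + k) - K.Ly i k * K.Hy j (i + k)
  HHx : ∀ i j k : ℤ, 0 = K.Hx j k * K.Hx i (j + k) - K.Hx i k * K.Hx j (i + k)
  HHy : ∀ i j k : ℤ, 0 = K.Hy j k * K.Hy i (j + k) - K.Hy i k * K.Hy j (i + k)
  LPx : ∀ i j k : ℤ, ((i : ℂ) / 2 - j) * K.Gpx (i + j) k =
    K.Gpx j k * K.Ly i (j + k) - K.Lx i k * K.Gpx j (i + k)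
  LPy : ∀ i j k : ℤ, ((i : ℂ) / 2 - j) * K.Gpy (i + j) k =
    K.Gpy j k * K.Lx i (j + k) - K.Ly i k * K.Gpy j (i + k)
  LMx : ∀ i j k : ℤ, ((i : ℂ) / 2 - j) * K.Gmx (i + j) k =
    K.Gmx j k * K.Ly i (j + k) - K.Lx i k * K.Gmx j (i + k)
  LMy : ∀ i j k : ℤ, ((i : ℂ) / 2 - j) * K.Gmy (i + j) k =
    K.Gmy j k * K.Lx i (j + k) - K.Ly i k * K.Gmy j (i + k)
  HPx : ∀ i j k : ℤ, K.Gpx (i + j) k = K.Gpx j k * K.Hy i (j + k) - K.Hx i k * K.Gpx j (i + k)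
  HPy : ∀ i j k : ℤ, K.Gpy (i + j) k = K.Gpy j k * K.Hx i (j + k) - K.Hy i k * K.Gpy j (i + k)
  HMx : ∀ i j k : ℤ, -K.Gmx (i + j) k = K.Gmx j k * K.Hy i (j + k) - K.Hx i k * K.Gmx j (i + k)
  HMy : ∀ i j k : ℤ, -K.Gmy (i + j) k = K.Gmy j k * K.Hx i (j + k) - K.Hy i k * K.Gmy j (i + k)
  PPx : ∀ i j k : ℤ, 0 = K.Gpx j k * K.Gpy i (j + k) + K.Gpx i k * K.Gpy j (i + k)
  PPy : ∀ i j k : ℤ, 0 = K.Gpy j k * K.Gpx i (j + k) + K.Gpy i k * K.Gpx j (i + k)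
  MMx : ∀ i j k : ℤ, 0 = K.Gmx j k * K.Gmy i (j + k) + K.Gmx i k * K.Gmy j (i + k)
  MMy : ∀ i j k : ℤ, 0 = K.Gmy j k * K.Gmx i (j + k) + K.Gmy i k * K.Gmx j (i + k)
  MPx : ∀ i j k : ℤ, 2 * K.Lx (i + j) k - ((i : ℂ) - j) * K.Hx (i + j) k =
    K.Gpx j k * K.Gmy i (j + k) + K.Gmx i k * K.Gpy j (i + k)
  MPy : ∀ i j k : ℤ, 2 * K.Ly (i + j) k - ((i : ℂ) - j) * K.Hy (i + j) k =
    K.Gpy j k * K.Gmx i (j + k) + K.Gmy i k * K.Gpx j (i + k)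

variable (K : Coeffs)

theorem ofValues_vx (u v : ℤ → XYSpace) (j : ℤ) : ofValues u v (vx j) = u j := by
  simp [ofValues, vx]

theorem ofValues_vy (u v : ℤ → XYSpace) (j : ℤ) : ofValues u v (vy j) = v j := by
  simp [ofValues, vy]


theorem op_mem (x : RamondBasis) (i : ℤ ⊕ ℤ) :
    K.op x (single i 1) ∈ homogeneous parityXY (x.parity + parityXY i) := by
  have hx : ∀ j, vx j ∈ homogeneous parityXY 0 := fun j => single_mem _ rfl _
  have hy : ∀ j, vy j ∈ homogeneous parityXY 1 := fun j => single_mem _ rfl _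
  have h11 : (1 : ZMod 2) + 1 = 0 := rfl
  have ex : ∀ j, single (Sum.inl j) 1 = vx j := fun _ => rfl
  have ey : ∀ j, single (Sum.inr j) 1 = vy j := fun _ => rfl
  rcases x with _ | _ | _ | _ | _ <;> rcases i with _ | _ <;>
    simp only [op, ex, ey, ofValues_vx, ofValues_vy, RamondBasis.parity, parityXY, Sum.elim_inl,
      Sum.elim_inr, add_zero, zero_add, h11, LinearMap.zero_apply] <;>
    first
    | exact Submodule.zero_mem _
    | exact Submodule.smul_mem _ _ (hx _)
    | exact Submodule.smul_mem _ _ (hy _)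

theorem end_ext {f g : Module.End ℂ XYSpace} (hx : ∀ k, f (vx k) = g (vx k))
    (hy : ∀ k, f (vy k) = g (vy k)) : f = g := by
  refine Finsupp.lhom_ext' fun k => LinearMap.ext_ring ?_
  rcases k with k | k
  · exact hx k
  · exact hy k

/-- Compatibility of `op` with the bracket of two basis elements. -/
def Compat (x y : RamondBasis) : Prop :=
  linearCombination ℂ K.op (bracketBasis x y) =
      K.op x * K.op y - koszulSign x.parity y.parity • (K.op y * K.op x)

variable {K}

theorem compat_symm {x y : RamondBasis} (h : K.Compat x y) : K.Compat y x := by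
  unfold Compat at h ⊢
  rw [bracketBasis_skew y x, map_neg, map_smul, h]
  refine LinearMap.ext fun v => ?_
  simp only [LinearMap.neg_apply, LinearMap.smul_apply, LinearMap.sub_apply,
    Module.End.mul_apply]
  have hs : koszulSign x.parity y.parity * koszulSign y.parity x.parity = 1 := by
    unfold koszulSign
    by_cases h1 : x.parity = 1 <;> by_cases h2 : y.parity = 1 <;> simp [h1, h2]
  linear_combination (norm := module) (hs) • (K.op y (K.op x v))

theorem compat (hK : K.Relations) (x y : RamondBasis) : K.Compat x y := by
  have h01 : ¬ (0 : ZMod 2) = 1 := by decide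
  have eL : ∀ i, linearCombination ℂ K.op (L i) = K.op (.L i) := fun i => by simp [L]
  have eH : ∀ i, linearCombination ℂ K.op (H i) = K.op (.H i) := fun i => by simp [H]
  have eP : ∀ i, linearCombination ℂ K.op (Gp i) = K.op (.Gp i) := fun i => by simp [Gp]
  have eM : ∀ i, linearCombination ℂ K.op (Gm i) = K.op (.Gm i) := fun i => by simp [Gm]
  have eC : linearCombination ℂ K.op C = 0 := by simp [C, op]
  have hC : ∀ x, K.Compat x .C := fun x => by
    
    unfold Compat
    rw [bracketBasis_C, map_zero]
    refine LinearMap.ext fun v => ?_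
    simp [op]
  have c1 : ∀ i j k : ℤ, i + (j + k) = i + j + k := fun i j k => by ring
  have c2 : ∀ i j k : ℤ, j + i + k = i + j + k := fun i j k => by ring
  have LL : ∀ i j, K.Compat (.L i) (.L j) := fun i j => by
    refine end_ext (fun k => ?_) (fun k => ?_)
    all_goals
      simp only [RamondBasis.parity, bracketBasis, koszulSign, h01, and_self, and_false, false_and,
        if_true, if_false, map_add, map_sub, map_neg, map_smul, map_zero, eL, eH, eP, eM, eC,
        LinearMap.add_apply, LinearMap.sub_apply, LinearMap.neg_apply, LinearMap.smul_apply,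
        LinearMap.zero_apply, Module.End.mul_apply, op, ofValues_vx, ofValues_vy, c1, c2 i j k]
    · linear_combination (norm := module) (hK.LLx i j k) • vx (i + j + k)
    · linear_combination (norm := module) (hK.LLy i j k) • vy (i + j + k)
  have LH : ∀ i j, K.Compat (.L i) (.H j) := fun i j => by
    refine end_ext (fun k => ?_) (fun k => ?_)
    all_goals
      simp only [RamondBasis.parity, bracketBasis, koszulSign, h01, and_self, and_false, false_and,
        if_true, if_false, map_add, map_sub, map_neg, map_smul, map_zero, eL, eH, eP, eM, eC,
        LinearMap.add_apply, LinearMap.sub_apply, LinearMap.neg_apply, LinearMap.smul_apply,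
        LinearMap.zero_apply, Module.End.mul_apply, op, ofValues_vx, ofValues_vy, c1, c2 i j k]
    · linear_combination (norm := module) (hK.LHx i j k) • vx (i + j + k)
    · linear_combination (norm := module) (hK.LHy i j k) • vy (i + j + k)
  have HH : ∀ i j, K.Compat (.H i) (.H j) := fun i j => by
    refine end_ext (fun k => ?_) (fun k => ?_)
    all_goals
      simp only [RamondBasis.parity, bracketBasis, koszulSign, h01, and_self, and_false, false_and,
        if_true, if_false, map_add, map_sub, map_neg, map_smul, map_zero, eL, eH, eP, eM, eC,
        LinearMap.add_apply, LinearMap.sub_apply, LinearMap.neg_apply, LinearMap.smul_apply,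
        LinearMap.zero_apply, Module.End.mul_apply, op, ofValues_vx, ofValues_vy, c1, c2 i j k]
    · linear_combination (norm := module) (hK.HHx i j k) • vx (i + j + k)
    · linear_combination (norm := module) (hK.HHy i j k) • vy (i + j + k)
  have LP : ∀ i j, K.Compat (.L i) (.Gp j) := fun i j => by
    refine end_ext (fun k => ?_) (fun k => ?_)
    all_goals
      simp only [RamondBasis.parity, bracketBasis, koszulSign, h01, and_self, and_false, false_and,
        if_true, if_false, map_add, map_sub, map_neg, map_smul, map_zero, eL, eH, eP, eM, eC,
        LinearMap.add_apply, LinearMap.sub_apply, LinearMap.neg_apply, LinearMap.smul_apply,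
        LinearMap.zero_apply, Module.End.mul_apply, op, ofValues_vx, ofValues_vy, c1, c2 i j k]
    · linear_combination (norm := module) (hK.LPx i j k) • vy (i + j + k)
    · linear_combination (norm := module) (hK.LPy i j k) • vx (i + j + k)
  have LM : ∀ i j, K.Compat (.L i) (.Gm j) := fun i j => by
    refine end_ext (fun k => ?_) (fun k => ?_)
    all_goals
      simp only [RamondBasis.parity, bracketBasis, koszulSign, h01, and_self, and_false, false_and,
        if_true, if_false, map_add, map_sub, map_neg, map_smul, map_zero, eL, eH, eP, eM, eC,
        LinearMap.add_apply, LinearMap.sub_apply, LinearMap.neg_apply, LinearMap.smul_apply,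
        LinearMap.zero_apply, Module.End.mul_apply, op, ofValues_vx, ofValues_vy, c1, c2 i j k]
    · linear_combination (norm := module) (hK.LMx i j k) • vy (i + j + k)
    · linear_combination (norm := module) (hK.LMy i j k) • vx (i + j + k)
  have HP : ∀ i j, K.Compat (.H i) (.Gp j) := fun i j => by
    refine end_ext (fun k => ?_) (fun k => ?_)
    all_goals
      simp only [RamondBasis.parity, bracketBasis, koszulSign, h01, and_self, and_false, false_and,
        if_true, if_false, map_add, map_sub, map_neg, map_smul, map_zero, eL, eH, eP, eM, eC,
        LinearMap.add_apply, LinearMap.sub_apply, LinearMap.neg_apply, LinearMap.smul_apply,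
        LinearMap.zero_apply, Module.End.mul_apply, op, ofValues_vx, ofValues_vy, c1, c2 i j k]
    · linear_combination (norm := module) (hK.HPx i j k) • vy (i + j + k)
    · linear_combination (norm := module) (hK.HPy i j k) • vx (i + j + k)
  have HM : ∀ i j, K.Compat (.H i) (.Gm j) := fun i j => by
    refine end_ext (fun k => ?_) (fun k => ?_)
    all_goals
      simp only [RamondBasis.parity, bracketBasis, koszulSign, h01, and_self, and_false, false_and,
        if_true, if_false, map_add, map_sub, map_neg, map_smul, map_zero, eL, eH, eP, eM, eC,
        LinearMap.add_apply, LinearMap.sub_apply, LinearMap.neg_apply, LinearMap.smul_apply,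
        LinearMap.zero_apply, Module.End.mul_apply, op, ofValues_vx, ofValues_vy, c1, c2 i j k]
    · linear_combination (norm := module) (hK.HMx i j k) • vy (i + j + k)
    · linear_combination (norm := module) (hK.HMy i j k) • vx (i + j + k)
  have PP : ∀ i j, K.Compat (.Gp i) (.Gp j) := fun i j => by
    refine end_ext (fun k => ?_) (fun k => ?_)
    all_goals
      simp only [RamondBasis.parity, bracketBasis, koszulSign, h01, and_self, and_false, false_and,
        if_true, if_false, map_add, map_sub, map_neg, map_smul, map_zero, eL, eH, eP, eM, eC,
        LinearMap.add_apply, LinearMap.sub_apply, LinearMap.neg_apply, LinearMap.smul_apply,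
        LinearMap.zero_apply, Module.End.mul_apply, op, ofValues_vx, ofValues_vy, c1, c2 i j k]
    · linear_combination (norm := module) (hK.PPx i j k) • vx (i + j + k)
    · linear_combination (norm := module) (hK.PPy i j k) • vy (i + j + k)
  have MM : ∀ i j, K.Compat (.Gm i) (.Gm j) := fun i j => by
    refine end_ext (fun k => ?_) (fun k => ?_)
    all_goals
      simp only [RamondBasis.parity, bracketBasis, koszulSign, h01, and_self, and_false, false_and,
        if_true, if_false, map_add, map_sub, map_neg, map_smul, map_zero, eL, eH, eP, eM, eC,
        LinearMap.add_apply, LinearMap.sub_apply, LinearMap.neg_apply, LinearMap.smul_apply,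
        LinearMap.zero_apply, Module.End.mul_apply, op, ofValues_vx, ofValues_vy, c1, c2 i j k]
    · linear_combination (norm := module) (hK.MMx i j k) • vx (i + j + k)
    · linear_combination (norm := module) (hK.MMy i j k) • vy (i + j + k)
  have MP : ∀ i j, K.Compat (.Gm i) (.Gp j) := fun i j => by
    refine end_ext (fun k => ?_) (fun k => ?_)
    all_goals
      simp only [RamondBasis.parity, bracketBasis, koszulSign, h01, and_self, and_false, false_and,
        if_true, if_false, map_add, map_sub, map_neg, map_smul, map_zero, eL, eH, eP, eM, eC,
        LinearMap.add_apply, LinearMap.sub_apply, LinearMap.neg_apply, LinearMap.smul_apply,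
        LinearMap.zero_apply, Module.End.mul_apply, op, ofValues_vx, ofValues_vy, c1, c2 i j k]
    · linear_combination (norm := module) (hK.MPx i j k) • vx (i + j + k)
    · linear_combination (norm := module) (hK.MPy i j k) • vy (i + j + k)
  match x, y with
  | .L i, .L j => exact LL i j
  | .L i, .H j => exact LH i j
  | .H i, .L j => exact compat_symm (LH j i)
  | .H i, .H j => exact HH i j
  | .L i, .Gp j => exact LP i j
  | .Gp i, .L j => exact compat_symm (LP j i)
  | .L i, .Gm j => exact LM i j
  | .Gm i, .L j => exact compat_symm (LM j i)
  | .H i, .Gp j => exact HP i j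
  | .Gp i, .H j => exact compat_symm (HP j i)
  | .H i, .Gm j => exact HM i j
  | .Gm i, .H j => exact compat_symm (HM j i)
  | .Gp i, .Gp j => exact PP i j
  | .Gm i, .Gm j => exact MM i j
  | .Gm i, .Gp j => exact MP i j
  | .Gp i, .Gm j => exact compat_symm (MP j i)
  | x, .C => exact hC x
  | .C, y => exact compat_symm (hC y)

/-- The module with the given structure coefficients. -/
def toModule (K : Coeffs) (hK : K.Relations) : algebra.SuperModule XYSpace :=
  moduleOfBasis parityXY K.op K.op_mem (compat hK)

end Coeffs

/-- The structure coefficients of `RA_{a,b}`. -/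
def RACoeffs (a b : ℂ) : Coeffs where
  Lx i j := a - j + i * b
  Ly i j := a - j + i * (b + 1 / 2)
  Hx _ _ := -(2 * b + 2)
  Hy _ _ := -(2 * b + 1)
  Gpx _ _ := 1
  Gpy _ _ := 0
  Gmx _ _ := 0
  Gmy i j := 2 * (a + i - j + 2 * i * b)

theorem RA_relations (a b : ℂ) : (RACoeffs a b).Relations := by
  constructor <;> intro i j k <;> simp only [RACoeffs] <;> push_cast <;>
    ring1

/-- The module `RA_{a,b}`:
`L_i x_j = (a - j + i b) x_{i+j}`, `L_i y_j = (a - j + i (b + 1/2)) y_{i+j}`,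
`H_i x_j = -(2b + 2) x_{i+j}`, `H_i y_j = -(2b + 1) y_{i+j}`, `G_i^+ x_j = y_{i+j}`,
`G_i^- y_j = 2 (a + i - j + 2 i b) x_{i+j}`, `G_i^- x_j = G_i^+ y_j = 0`. -/
def RA (a b : ℂ) : algebra.SuperModule XYSpace :=
  (RACoeffs a b).toModule (RA_relations a b)

/-- The structure coefficients of `RB_{a,b}`. -/
def RBCoeffs (a b : ℂ) : Coeffs where
  Lx i j := a - j + i * b
  Ly i j := a - j + i * (b + 1 / 2)
  Hx _ _ := 2 * b + 2
  Hy _ _ := 2 * b + 1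
  Gpx _ _ := 0
  Gpy i j := 2 * (a + i - j + 2 * i * b)
  Gmx _ _ := 1
  Gmy _ _ := 0

theorem RB_relations (a b : ℂ) : (RBCoeffs a b).Relations := by
  constructor <;> intro i j k <;> simp only [RBCoeffs] <;> push_cast <;>
    ring1

/-- The module `RB_{a,b}`:
`L_i x_j = (a - j + i b) x_{i+j}`, `L_i y_j = (a - j + i (b + 1/2)) y_{i+j}`,
`H_i x_j = (2b + 2) x_{i+j}`, `H_i y_j = (2b + 1) y_{i+j}`, `G_i^- x_j = y_{i+j}`,
`G_i^+ y_j = 2 (a + i - j + 2 i b) x_{i+j}`, `G_i^+ x_j = G_i^- y_j = 0`. -/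
def RB (a b : ℂ) : algebra.SuperModule XYSpace :=
  (RBCoeffs a b).toModule (RB_relations a b)

/-- The structure coefficients of `RA_α`. -/
def RAlowerCoeffs (α : ℂ) : Coeffs where
  Lx i j := if j = 0 then i * α + (i : ℂ) ^ 2 / 2 else -((i : ℂ) + j)
  Ly i j := -((i : ℂ) / 2 + j)
  Hx i j := if j = 0 then i else 0
  Hy _ _ := 1
  Gpx i j := if j = 0 then -(α + i) else 1
  Gpy _ _ := 0
  Gmx _ _ := 0
  Gmy i j := -2 * ((i : ℂ) + j)

theorem RAlower_relations (α : ℂ) : (RAlowerCoeffs α).Relations := by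
  constructor <;> intro i j k <;> simp only [RAlowerCoeffs] <;> push_cast <;>
    first
    | ring1
    | (split_ifs <;> (simp only [← @Int.cast_inj ℂ] at *; push_cast at *; grind))

/-- The module `RA_α`, for `k ≠ 0` and all `j`:
`L_i x_k = -(i + k) x_{i+k}`, `L_i x_0 = (i α + i^2/2) x_i`, `L_i y_j = -(i/2 + j) y_{i+j}`,
`H_i y_j = y_{i+j}`, `H_i x_k = 0`, `H_i x_0 = i x_i`, `G_i^- x_j = G_i^+ y_j = 0`,
`G_i^- y_j = -2 (i + j) x_{i+j}`, `G_i^+ x_k = y_{i+k}`, `G_i^+ x_0 = -(α + i) y_i`. -/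
def RAlower (α : ℂ) : algebra.SuperModule XYSpace :=
  (RAlowerCoeffs α).toModule (RAlower_relations α)

/-- The structure coefficients of `RA^β`. -/
def RAupperCoeffs (β : ℂ) : Coeffs where
  Lx i j := -((i : ℂ) / 2 + j)
  Ly i j := if i + j = 0 then i * β + (i : ℂ) ^ 2 / 2 else -(j : ℂ)
  Hx _ _ := -1
  Hy i j := if i + j = 0 then i else 0
  Gpx i j := if i + j = 0 then β + i else 1
  Gpy _ _ := 0
  Gmx _ _ := 0
  Gmy _ j := -2 * (j : ℂ)

theorem RAupper_relations (β : ℂ) : (RAupperCoeffs β).Relations := by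
  constructor <;> intro i j k <;> simp only [RAupperCoeffs] <;> push_cast <;>
    first
    | ring1
    | (split_ifs <;> (simp only [← @Int.cast_inj ℂ] at *; push_cast at *; grind))

/-- The module `RA^β`, for `k ≠ -i` and all `j`:
`L_i x_j = -(i/2 + j) x_{i+j}`, `L_i y_k = -k y_{i+k}`, `L_i y_{-i} = (i β + i^2/2) y_0`,
`H_i x_j = -x_{i+j}`, `H_i y_k = 0`, `H_i y_{-i} = i y_0`, `G_i^- x_j = G_i^+ y_j = 0`,
`G_i^+ x_k = y_{i+k}`, `G_i^+ x_{-i} = (β + i) y_0`, `G_i^- y_j = -2 j x_{i+j}`. -/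
def RAupper (β : ℂ) : algebra.SuperModule XYSpace :=
  (RAupperCoeffs β).toModule (RAupper_relations β)

/-- The structure coefficients of `RB_α`. -/
def RBlowerCoeffs (α : ℂ) : Coeffs where
  Lx i j := if j = 0 then -(i * α + (i : ℂ) ^ 2 / 2) else -((i : ℂ) + j)
  Ly i j := -((i : ℂ) / 2 + j)
  Hx i j := if j = 0 then i else 0
  Hy _ _ := -1
  Gpx _ _ := 0
  Gpy i j := -2 * ((i : ℂ) + j)
  Gmx i j := if j = 0 then α + i else 1
  Gmy _ _ := 0

theorem RBlower_relations (α : ℂ) : (RBlowerCoeffs α).Relations := by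
  constructor <;> intro i j k <;> simp only [RBlowerCoeffs] <;> push_cast <;>
    first
    | ring1
    | (split_ifs <;> (simp only [← @Int.cast_inj ℂ] at *; push_cast at *; grind))

/-- The module `RB_α`, for `k ≠ 0` and all `j`:
`L_i x_k = -(i + k) x_{i+k}`, `L_i x_0 = -(i α + i^2/2) x_i`, `L_i y_j = -(i/2 + j) y_{i+j}`,
`H_i y_j = -y_{i+j}`, `H_i x_k = 0`, `H_i x_0 = i x_i`, `G_i^+ x_j = G_i^- y_j = 0`,
`G_i^+ y_j = -2 (i + j) x_{i+j}`, `G_i^- x_k = y_{i+k}`, `G_i^- x_0 = (α + i) y_i`. -/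
def RBlower (α : ℂ) : algebra.SuperModule XYSpace :=
  (RBlowerCoeffs α).toModule (RBlower_relations α)

/-- The structure coefficients of `RB^β`. -/
def RBupperCoeffs (β : ℂ) : Coeffs where
  Lx i j := -((i : ℂ) / 2 + j)
  Ly i j := if i + j = 0 then -(i * β + (i : ℂ) ^ 2 / 2) else -(j : ℂ)
  Hx _ _ := 1
  Hy i j := if i + j = 0 then i else 0
  Gpx _ _ := 0
  Gpy _ j := -2 * (j : ℂ)
  Gmx i j := if i + j = 0 then -(β + i) else 1
  Gmy _ _ := 0

theorem RBupper_relations (β : ℂ) : (RBupperCoeffs β).Relations := by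
  constructor <;> intro i j k <;> simp only [RBupperCoeffs] <;> push_cast <;>
    first
    | ring1
    | (split_ifs <;> (simp only [← @Int.cast_inj ℂ] at *; push_cast at *; grind))

/-- The module `RB^β`, for `k ≠ -i` and all `j`:
`L_i x_j = -(i/2 + j) x_{i+j}`, `L_i y_k = -k y_{i+k}`, `L_i y_{-i} = -(i β + i^2/2) y_0`,
`H_i x_j = x_{i+j}`, `H_i y_k = 0`, `H_i y_{-i} = i y_0`, `G_i^+ x_j = G_i^- y_j = 0`,
`G_i^- x_k = y_{i+k}`, `G_i^- x_{-i} = -(β + i) y_0`, `G_i^+ y_j = -2 j x_{i+j}`. -/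
def RBupper (β : ℂ) : algebra.SuperModule XYSpace :=
  (RBupperCoeffs β).toModule (RBupper_relations β)

/-! ### Weight modules and modules of the intermediate series -/

/-- The Cartan subalgebra `ℂ L_0 + ℂ H_0 + ℂ c`. -/
def cartan : Submodule ℂ RamondSpace := Submodule.span ℂ {L 0, H 0, C}

variable {V : Type*} [AddCommGroup V] [Module ℂ V]

/-- The weight space of weight `w`. -/
def weightSpace (M : algebra.SuperModule V) (w : Module.Dual ℂ cartan) : Submodule ℂ V :=
  ⨅ h : cartan, Module.End.eigenspace (M.act h) (w h)

open scoped Classical in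
/-- `V` is the direct sum of its weight spaces, and these are finite-dimensional. -/
def IsHarishChandra (M : algebra.SuperModule V) : Prop :=
  DirectSum.IsInternal (weightSpace M) ∧
    ∀ w : Module.Dual ℂ cartan, FiniteDimensional ℂ (weightSpace M w)

/-- Modules of the intermediate series: indecomposable Harish-Chandra modules `V = V₀ ⊕ V₁` such that
the `L_0`-weight spaces `V_p^μ = {v ∈ V_p | L_0 v = μ v}` of the even part and of the odd part have
dimension at most one. -/
def IsIntermediateSeries (M : algebra.SuperModule V) : Prop :=
  M.IsIndecomposable ∧ IsHarishChandra M ∧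
    ∀ (p : ZMod 2) (μ : ℂ),
      Module.rank ℂ ↥(M.part p ⊓ Module.End.eigenspace (M.act (L 0)) μ) ≤ 1

end Ramond

end

/-!
The proof looks at the lines `ℂ X_j = V_0^{a-j}` and `ℂ Y_j = V_1^{a-j}`, which are permuted by the basis
elements of the algebra and are stable under `H_0`, so that each has an `H_0`-weight. Indecomposability
makes the central element a scalar and the eigenvalues of `L_0` one coset of `ℤ`. The scalar is zero
because a Heisenberg algebra with nonzero central charge cannot permute lines
(`heisenberg_central_eq_zero`). Since `G_i^±` generate the algebra modulo its centre (`eq_top_of_odd`), it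
remains to determine their structure coefficients.

On `X_j` the operators `G_i^+`, `G_{-i}^-` satisfy `{G_{-i}^-, G_i^+} = 2 (a - j + i h)`, where `h` is the
`H_0`-weight. If this number is nonzero, exactly one of the two does not kill `X_j` (`P_or_Q`). The
images of `X_j` under `G^+` and `G^-` have the different weights `h + 1` and `h - 1`, and as there is only
one odd line in each position, it follows that the choice between `G^+` and `G^-` does not depend on `i`
(`type_dichotomy`). So, unless all `L_0`- and `H_0`-weights vanish, and up to parity and the automorphism
that exchanges `G^+` and `G^-`, all even vectors have one weight `w`, all odd vectors have weight
`w + 1`, `G^-` kills the even part and `G^+` the odd part (`uniform_of_type`).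

With `G_{n-j}^+ X_j = p n j • Y_n` and `G_{t-n}^- Y_n = q t n • X_t`, the products `q t n * p n j` are affine
functions of `n`, and those with `t = j` are known. Unique factorisation then shows that `p` or `q` has
rank one if `w ≠ 0, -1`, which gives `RA_{a,b}` or `RB_{a,b}` (`AffinePair.rank_one`). For `w = 0` both have
rank one away from position `a`. If the weight space in that position is nonzero and `a` is an integer,
it is attached to the rest through a single nonzero affine function, which gives the modules with an
exceptional basis vector (`Uniform.covered_zero`). Parity reversal and the automorphism reduce `w = -1`
to `w = 0`.
-/

noncomputable section

open Finsupp

namespace Ramond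

/-! ### Actions that permute lines -/

/-- An action of the Ramond algebra with trivial central element, written through the operators
`L_i`, `H_i`, `P_i = G_i^+`, `Q_i = G_i^-`, together with lines `ℂ X_j` (even) and `ℂ Y_j` (odd) of
joint eigenvectors of `L_0` and `H_0` which are permuted by the operators. A generator `X_j` or `Y_j`
may be zero, which means that the corresponding weight space is zero. The number `a` is the
`L_0`-eigenvalue in position `0`, and positions are numbered so that `a = 0` as soon as `a` is an
integer. -/
structure LineRep (V : Type*) [AddCommGroup V] [Module ℂ V] where
  L : ℤ → Module.End ℂ V
  H : ℤ → Module.End ℂ V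
  P : ℤ → Module.End ℂ V
  Q : ℤ → Module.End ℂ V
  X : ℤ → V
  Y : ℤ → V
  a : ℂ
  h : ℤ → ℂ
  k : ℤ → ℂ
  int_a : ∀ m : ℤ, a = m → m = 0
  LL : ∀ i j v, L i (L j v) - L j (L i v) = ((i : ℂ) - j) • L (i + j) v
  LH : ∀ i j v, L i (H j v) - H j (L i v) = (-(j : ℂ)) • H (i + j) v
  HH : ∀ i j v, H i (H j v) = H j (H i v)
  HP : ∀ i j v, H i (P j v) - P j (H i v) = P (i + j) v
  HQ : ∀ i j v, H i (Q j v) - Q j (H i v) = -Q (i + j) v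
  PP : ∀ i j v, P i (P j v) + P j (P i v) = 0
  QQ : ∀ i j v, Q i (Q j v) + Q j (Q i v) = 0
  QP : ∀ i j v, Q i (P j v) + P j (Q i v) = (2 : ℂ) • L (i + j) v - ((i : ℂ) - j) • H (i + j) v
  LX : ∀ i j, ∃ r : ℂ, L i (X j) = r • X (i + j)
  LY : ∀ i j, ∃ r : ℂ, L i (Y j) = r • Y (i + j)
  HX : ∀ i j, ∃ r : ℂ, H i (X j) = r • X (i + j)
  HY : ∀ i j, ∃ r : ℂ, H i (Y j) = r • Y (i + j)
  PX : ∀ i j, ∃ r : ℂ, P i (X j) = r • Y (i + j)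
  PY : ∀ i j, ∃ r : ℂ, P i (Y j) = r • X (i + j)
  QX : ∀ i j, ∃ r : ℂ, Q i (X j) = r • Y (i + j)
  QY : ∀ i j, ∃ r : ℂ, Q i (Y j) = r • X (i + j)
  L0X : ∀ j, L 0 (X j) = (a - j) • X j
  L0Y : ∀ j, L 0 (Y j) = (a - j) • Y j
  H0X : ∀ j, H 0 (X j) = h j • X j
  H0Y : ∀ j, H 0 (Y j) = k j • Y j

namespace LineRep

variable {V : Type*} [AddCommGroup V] [Module ℂ V] (R : LineRep V)

/-- Reversal of parity. -/
def swap : LineRep V where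
  __ := R
  X := R.Y
  Y := R.X
  h := R.k
  k := R.h
  LX := R.LY
  LY := R.LX
  HX := R.HY
  HY := R.HX
  PX := R.PY
  PY := R.PX
  QX := R.QY
  QY := R.QX
  L0X := R.L0Y
  L0Y := R.L0X
  H0X := R.H0Y
  H0Y := R.H0X

/-- The twist by the automorphism `H_i ↦ -H_i`, `G_i^± ↦ G_i^∓` of the Ramond algebra. -/
def flip : LineRep V where
  __ := R
  H i := -R.H i
  P := R.Q
  Q := R.P
  h j := -R.h j
  k j := -R.k j
  LH i j v := by
    have := R.LH i j v
    simp only [LinearMap.neg_apply, map_neg, smul_neg]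
    rw [← this]; abel
  HH i j v := by
    simp only [LinearMap.neg_apply, map_neg]
    rw [R.HH]
  HP i j v := by
    simp only [LinearMap.neg_apply, map_neg]
    rw [← neg_neg (R.Q (i + j) v), ← R.HQ i j v]; abel
  HQ i j v := by
    simp only [LinearMap.neg_apply, map_neg]
    rw [← R.HP i j v]; abel
  PP := R.QQ
  QQ := R.PP
  QP i j v := by
    have := R.QP j i v
    simp only [LinearMap.neg_apply]
    rw [add_comm i j, add_comm (R.P i _), this]
    module
  HX i j := by
    obtain ⟨r, hr⟩ := R.HX i j
    exact ⟨-r, by simp [hr]⟩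
  HY i j := by
    obtain ⟨r, hr⟩ := R.HY i j
    exact ⟨-r, by simp [hr]⟩
  PX := R.QX
  PY := R.QY
  QX := R.PX
  QY := R.PY
  H0X j := by simp [R.H0X]
  H0Y j := by simp [R.H0Y]

/-! ### Weights of the odd operators -/

variable {R}

theorem ne_zero_of_H0 {Z : V} {u : V} {r w w' : ℂ} (hu : u = r • Z) (hne : u ≠ 0)
    (h1 : R.H 0 u = w • u) (h2 : R.H 0 Z = w' • Z) : Z ≠ 0 ∧ w' = w := by
  subst hu
  have hZ : Z ≠ 0 := fun h => hne (by simp [h])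
  refine ⟨hZ, ?_⟩
  rw [map_smul, h2, smul_comm] at h1
  exact smul_left_injective ℂ hne h1

theorem H0_P {v : V} {w : ℂ} (hv : R.H 0 v = w • v) (i : ℤ) :
    R.H 0 (R.P i v) = (w + 1) • R.P i v := by
  have := R.HP 0 i v
  rw [hv, zero_add, map_smul] at this
  linear_combination (norm := module) this

theorem H0_Q {v : V} {w : ℂ} (hv : R.H 0 v = w • v) (i : ℤ) :
    R.H 0 (R.Q i v) = (w - 1) • R.Q i v := by
  have := R.HQ 0 i v
  rw [hv, zero_add, map_smul] at this
  linear_combination (norm := module) this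

theorem H0_H {v : V} {w : ℂ} (hv : R.H 0 v = w • v) (i : ℤ) :
    R.H 0 (R.H i v) = w • R.H i v := by
  rw [R.HH, hv, map_smul]

theorem H0_L {v : V} {w : ℂ} (hv : R.H 0 v = w • v) (i : ℤ) :
    R.H 0 (R.L i v) = w • R.L i v := by
  have := R.LH i 0 v
  rw [hv, map_smul] at this
  simp only [Int.cast_zero, neg_zero, zero_smul] at this
  linear_combination (norm := module) -this

theorem weight_of_P_ne {i j : ℤ} (hne : R.P i (R.X j) ≠ 0) :
    R.Y (i + j) ≠ 0 ∧ R.k (i + j) = R.h j + 1 := by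
  obtain ⟨r, hr⟩ := R.PX i j
  exact ne_zero_of_H0 hr hne (H0_P (R.H0X j) i) (R.H0Y _)

theorem weight_of_Q_ne {i j : ℤ} (hne : R.Q i (R.X j) ≠ 0) :
    R.Y (i + j) ≠ 0 ∧ R.k (i + j) = R.h j - 1 := by
  obtain ⟨r, hr⟩ := R.QX i j
  exact ne_zero_of_H0 hr hne (H0_Q (R.H0X j) i) (R.H0Y _)

theorem weight_of_H_ne {i j : ℤ} (hne : R.H i (R.X j) ≠ 0) :
    R.X (i + j) ≠ 0 ∧ R.h (i + j) = R.h j := by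
  obtain ⟨r, hr⟩ := R.HX i j
  exact ne_zero_of_H0 hr hne (H0_H (R.H0X j) i) (R.H0X _)

theorem P_sq (i : ℤ) (v : V) : R.P i (R.P i v) = 0 := by
  have := R.PP i i v
  rwa [← two_smul ℂ, smul_eq_zero_iff_right (two_ne_zero)] at this

theorem Q_sq (i : ℤ) (v : V) : R.Q i (R.Q i v) = 0 := by
  have := R.QQ i i v
  rwa [← two_smul ℂ, smul_eq_zero_iff_right (two_ne_zero)] at this

theorem QP_diag (i j : ℤ) : R.Q (-i) (R.P i (R.X j)) + R.P i (R.Q (-i) (R.X j)) =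
    (2 * (R.a - j + i * R.h j)) • R.X j := by
  rw [R.QP, neg_add_cancel, R.L0X, R.H0X]
  push_cast
  module

/-- On `X_j` the operators `G_i^+` and `G_{-i}^-` generate a copy of `𝔤𝔩(1|1)`. If its central element
acts by a nonzero scalar, exactly one of the two does not kill `X_j`. -/
theorem P_or_Q {i j : ℤ} (hX : R.X j ≠ 0) (hi : R.a - j + i * R.h j ≠ 0) :
    (R.P i (R.X j) ≠ 0 ∧ R.Q (-i) (R.X j) = 0 ∧ R.Q (-i) (R.P i (R.X j)) ≠ 0) ∨
    (R.P i (R.X j) = 0 ∧ R.Q (-i) (R.X j) ≠ 0 ∧ R.P i (R.Q (-i) (R.X j)) ≠ 0) := by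
  have hd := R.QP_diag i j
  obtain ⟨r, hr⟩ : ∃ r : ℂ, R.Q (-i) (R.P i (R.X j)) = r • R.X j := by
    obtain ⟨r, hr⟩ := R.PX i j
    obtain ⟨s, hs⟩ := R.QY (-i) (i + j)
    exact ⟨r * s, by rw [hr, map_smul, hs, neg_add_cancel_left, smul_smul]⟩
  obtain ⟨s, hs⟩ : ∃ s : ℂ, R.P i (R.Q (-i) (R.X j)) = s • R.X j := by
    obtain ⟨r, hr⟩ := R.QX (-i) j
    obtain ⟨s, hs⟩ := R.PY i (-i + j)
    exact ⟨r * s, by rw [hr, map_smul, hs, add_neg_cancel_left, smul_smul]⟩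
  have hsum : r + s = 2 * (R.a - j + i * R.h j) := by
    rw [hr, hs, ← add_smul] at hd
    exact smul_left_injective ℂ hX hd
  have hrs : s * r = 0 := by
    have : (s * r) • R.X j = 0 := by
      rw [mul_smul, ← hr, ← map_smul, ← map_smul, ← hs, P_sq, map_zero]
    exact (smul_eq_zero.1 this).resolve_right hX
  have hne : r + s ≠ 0 := by
    rw [hsum]
    exact mul_ne_zero two_ne_zero hi
  rcases mul_eq_zero.1 hrs with h0 | h0
  · have hr0 : r ≠ 0 := by simpa [h0] using hne
    have hQP : R.Q (-i) (R.P i (R.X j)) ≠ 0 := by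
      rw [hr]
      exact smul_ne_zero hr0 hX
    refine Or.inl ⟨fun h => hQP (by rw [h, map_zero]), ?_, hQP⟩
    have := congrArg (R.Q (-i)) hr
    rw [Q_sq, map_smul] at this
    exact (smul_eq_zero.1 this.symm).resolve_left hr0
  · have hs0 : s ≠ 0 := by simpa [h0] using hne
    have hPQ : R.P i (R.Q (-i) (R.X j)) ≠ 0 := by
      rw [hs]
      exact smul_ne_zero hs0 hX
    refine Or.inr ⟨?_, fun h => hPQ (by rw [h, map_zero]), hPQ⟩
    have := congrArg (R.P i) hs
    rw [P_sq, map_smul] at this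
    exact (smul_eq_zero.1 this.symm).resolve_left hs0

/-! ### Nontrivial weight vectors are of one of two types -/

theorem finite_affine_zeros {u v : ℂ} (h : u ≠ 0 ∨ v ≠ 0) :
    {i : ℤ | u + i * v = 0}.Finite := by
  refine Set.Subsingleton.finite fun i hi j hj => ?_
  simp only [Set.mem_ofPred_eq] at hi hj
  have hv : v ≠ 0 := by
    rintro rfl
    simp at hi h
    exact h hi
  have : ((i : ℂ) - j) * v = 0 := by linear_combination hi - hj
  exact_mod_cast sub_eq_zero.1 ((mul_eq_zero.1 this).resolve_right hv)

/-- The index `i` is exceptional for `X_j` if `{G_{-i}^-, G_i^+}` kills `X_j`. -/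
theorem finite_exceptional {j : ℤ} (hnt : ¬(R.h j = 0 ∧ R.a = j)) :
    {i : ℤ | R.a - j + i * R.h j = 0}.Finite := by
  refine finite_affine_zeros ?_
  by_contra! hc
  exact hnt ⟨hc.2, sub_eq_zero.1 hc.1⟩

/-- If `G_i^+ X_j ≠ 0` for all but finitely many `i`, then almost all odd lines have `H_0`-weight
`h_j + 1`, so `L_m` and `H_m` kill the odd vectors of weight `h_j - 1` for almost all `m`. By the
commutation relations `L_0` and `H_0` kill them too, which is impossible for a nonzero vector
`G_{-i}^- X_j` with `a - j + i h_j ≠ 0`. -/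
theorem P_ne_zero_of_finite {j : ℤ} (hX : R.X j ≠ 0)
    (hfin : {i : ℤ | R.P i (R.X j) = 0}.Finite) {i' : ℤ} (hi' : R.a - j + i' * R.h j ≠ 0) :
    R.P i' (R.X j) ≠ 0 := by
  intro hP
  rcases P_or_Q hX hi' with h | ⟨-, hQ, hPQ⟩
  · exact h.1 hP
  obtain ⟨-, hk⟩ := weight_of_Q_ne hQ
  have hbad : {m : ℤ | R.P (m - i') (R.X j) = 0}.Finite :=
    hfin.preimage (f := fun m : ℤ => m - i') (sub_left_injective.injOn)
  have key : ∀ m : ℤ, R.P (m - i') (R.X j) ≠ 0 →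
      R.L m (R.Y (-i' + j)) = 0 ∧ R.H m (R.Y (-i' + j)) = 0 := by
    intro m hm
    obtain ⟨-, hk'⟩ := weight_of_P_ne hm
    have hidx : m - i' + j = m + (-i' + j) := by ring
    rw [hidx] at hk'
    constructor
    · by_contra hne
      obtain ⟨r, hr⟩ := R.LY m (-i' + j)
      have := (ne_zero_of_H0 hr hne (H0_L (R.H0Y _) m) (R.H0Y _)).2
      rw [hk, hk'] at this
      have h2 : (2 : ℂ) = 0 := by linear_combination this
      exact two_ne_zero h2
    · by_contra hne
      obtain ⟨r, hr⟩ := R.HY m (-i' + j)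
      have := (ne_zero_of_H0 hr hne (H0_H (R.H0Y _) m) (R.H0Y _)).2
      rw [hk, hk'] at this
      have h2 : (2 : ℂ) = 0 := by linear_combination this
      exact two_ne_zero h2
  -- both `m` and `-m` are good, so that `L_0` and `H_0` are commutators of operators killing `Y`
  obtain ⟨m, hm⟩ := ((hbad.union (hbad.preimage (f := fun m : ℤ => -m) neg_injective.injOn)).union
    (Set.finite_singleton 0)).infinite_compl.nonempty
  simp only [Set.mem_compl_iff, Set.mem_union, Set.mem_ofPred_eq, Set.mem_preimage,
    Set.mem_singleton_iff, not_or] at hm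
  obtain ⟨⟨hm1, hm2⟩, hm0⟩ := hm
  have hmC : (m : ℂ) ≠ 0 := by exact_mod_cast hm0
  obtain ⟨l1, t1⟩ := key m hm1
  obtain ⟨l2, t2⟩ := key (-m) hm2
  have hH0 : R.H 0 (R.Y (-i' + j)) = 0 := by
    have := R.LH m (-m) (R.Y (-i' + j))
    rw [l1, t2, map_zero, map_zero, add_neg_cancel, sub_zero, eq_comm] at this
    refine (smul_eq_zero.1 this).resolve_left ?_
    push_cast
    simpa using hmC
  have hL0 : R.L 0 (R.Y (-i' + j)) = 0 := by
    have := R.LL m (-m) (R.Y (-i' + j))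
    rw [l1, l2, map_zero, map_zero, add_neg_cancel, sub_zero, eq_comm] at this
    refine (smul_eq_zero.1 this).resolve_left ?_
    push_cast
    intro h0
    exact hmC (by linear_combination h0 / 2)
  obtain ⟨r, hr⟩ := R.QX (-i') j
  have hz := R.QP (-i') i' (R.Q (-i') (R.X j))
  rw [Q_sq, map_zero, add_zero, neg_add_cancel, hr, map_smul (R.L 0), map_smul (R.H 0), hL0, hH0,
    ← hr] at hz
  have hd := R.QP_diag i' j
  rw [hP, map_zero, zero_add] at hd
  rw [hd, map_smul] at hz
  simp only [smul_zero, sub_zero] at hz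
  rcases smul_eq_zero.1 hz with h0 | h0
  · exact mul_ne_zero two_ne_zero hi' h0
  · exact hQ h0

/-- A weight vector `X_j` cannot have infinitely many nonzero images under the `G_i^+` and under the
`G_i^-` at the same time. For suitable `i, i'` with `G_i^+ X_j ≠ 0` and `G_{-i'}^- X_j ≠ 0`, the
disjointness of the `H_0`-weights `h_j + 1` and `h_j - 1` yields two different linear relations between
`L_{i'-i} X_j` and `H_{i'-i} X_j`, which contradicts `H_{i'-i} H_{i-i'} X_j ≠ 0`. -/
theorem not_infinite_infinite {j : ℤ} (hX : R.X j ≠ 0) (hnt : ¬(R.h j = 0 ∧ R.a = j))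
    (hp : {i : ℤ | R.a - j + i * R.h j ≠ 0 ∧ R.P i (R.X j) ≠ 0}.Infinite)
    (hm : {i : ℤ | R.a - j + i * R.h j ≠ 0 ∧ R.Q (-i) (R.X j) ≠ 0}.Infinite) : False := by
  have h20 : ¬(2 : ℂ) = 0 := two_ne_zero
  have hne : R.a - j ≠ 0 ∨ R.h j ≠ 0 := by
    by_contra! hc
    exact hnt ⟨hc.2, sub_eq_zero.1 hc.1⟩
  obtain ⟨i', ⟨hi'e, hi'Q⟩, hi'n⟩ := (hm.sdiff (finite_affine_zeros (u := R.a - j)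
    (v := -R.h j) (by simpa using hne))).nonempty
  simp only [Set.mem_ofPred_eq] at hi'n
  -- the values of `i` that would make one of the indices used below exceptional
  have f1 := finite_affine_zeros (u := R.a - j - i' * R.h j) (v := 2 * R.h j) (by
    by_contra! hc
    refine hi'n ?_
    linear_combination hc.1)
  have f2 := finite_affine_zeros (u := R.a - j + i') (v := -(1 + R.h j)) (by
    by_contra! hc
    refine hi'n ?_
    linear_combination hc.1 + i' * hc.2)
  have f3 := finite_affine_zeros (u := R.a - j + i') (v := R.h j - 1) (by
    by_contra! hc
    refine hi'e ?_
    linear_combination hc.1 + i' * hc.2)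
  obtain ⟨i, ⟨hie, hiP⟩, hi⟩ := (hp.sdiff (((f1.union f2).union f3).union
    (Set.finite_singleton 0))).nonempty
  simp only [Set.mem_union, Set.mem_ofPred_eq, Set.mem_singleton_iff, not_or] at hi
  obtain ⟨⟨⟨e1, e2⟩, e3⟩, hi0⟩ := hi
  have hiQ : R.Q (-i) (R.X j) = 0 := by
    rcases P_or_Q hX hie with h | h
    · exact h.2.1
    · exact absurd h.1 hiP
  have hi'P : R.P i' (R.X j) = 0 := by
    rcases P_or_Q hX hi'e with h | h
    · exact absurd h.2.1 hi'Q
    · exact h.1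
  obtain ⟨-, wP⟩ := weight_of_P_ne hiP
  obtain ⟨-, wQ⟩ := weight_of_Q_ne hi'Q
  have hP' : R.P i' (R.H (i - i') (R.X j)) ≠ 0 := by
    have := R.HP (i - i') i' (R.X j)
    rw [hi'P, map_zero, zero_sub, sub_add_cancel] at this
    rwa [← neg_ne_zero, this]
  have hQ' : R.Q (-i) (R.H (i - i') (R.X j)) ≠ 0 := by
    have := R.HQ (i - i') (-i) (R.X j)
    rw [hiQ, map_zero, zero_sub, neg_inj] at this
    rw [this]
    convert hi'Q using 3
    ring
  have hH : R.H (i - i') (R.X j) ≠ 0 := fun h => hP' (by rw [h, map_zero])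
  obtain ⟨hX', hh'⟩ := weight_of_H_ne hH
  obtain ⟨r, hr⟩ := R.HX (i - i') j
  have e2' : R.a - ((i - i' + j : ℤ) : ℂ) + ((-i : ℤ) : ℂ) * R.h (i - i' + j) ≠ 0 := by
    rw [hh']
    push_cast
    intro h
    exact e2 (by linear_combination h)
  have e3' : R.a - ((i - i' + j : ℤ) : ℂ) + (i : ℂ) * R.h (i - i' + j) ≠ 0 := by
    rw [hh']
    push_cast
    intro h
    exact e3 (by linear_combination h)
  have hPi : R.P i (R.H (i - i') (R.X j)) = 0 := by
    rcases P_or_Q hX' e3' with h | h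
    · exact absurd (by rw [hr, map_smul, h.2.1, smul_zero]) hQ'
    · rw [hr, map_smul, h.1, smul_zero]
  -- the odd vector in position `j + 2 i - i'` has weight `h_j - 1`
  have w1 : R.k (i + (i - i' + j)) = R.h j - 1 := by
    rcases P_or_Q hX' e2' with h | h
    · have := (weight_of_P_ne h.1).2
      rw [show -i + (i - i' + j) = -i' + j by ring, wQ, hh'] at this
      exact absurd (by linear_combination -this) h20
    · have := (weight_of_Q_ne h.2.1).2
      rwa [neg_neg, hh'] at this
  -- hence so does the one in position `j - (2 i - i')`
  have w2 : R.k (-(2 * i - i') + j) = R.h j - 1 := by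
    have e1' : R.a - j + ((2 * i - i' : ℤ) : ℂ) * R.h j ≠ 0 := by
      push_cast
      intro h
      exact e1 (by linear_combination h)
    rcases P_or_Q hX e1' with h | h
    · have := (weight_of_P_ne h.1).2
      rw [show 2 * i - i' + j = i + (i - i' + j) by ring, w1] at this
      exact absurd (by linear_combination -this) h20
    · exact (weight_of_Q_ne h.2.1).2
  have hP2 : R.P (-(2 * i - i')) (R.X j) = 0 := by
    by_contra h
    have := (weight_of_P_ne h).2
    rw [w2] at this
    exact absurd (by linear_combination -this) h20
  have hQ2 : R.Q i (R.X j) = 0 := by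
    by_contra h
    have := (weight_of_Q_ne h).2
    rw [wP] at this
    exact absurd (by linear_combination this) h20
  have r1 := R.QP (-i) i' (R.X j)
  have r2 := R.QP i (-(2 * i - i')) (R.X j)
  rw [hiQ, hi'P, map_zero, map_zero, add_zero, show -i + i' = -(i - i') by ring] at r1
  rw [hQ2, hP2, map_zero, map_zero, add_zero, show i + -(2 * i - i') = -(i - i') by ring] at r2
  have hH0 : R.H (-(i - i')) (R.X j) = 0 := by
    have : (4 * (i : ℂ)) • R.H (-(i - i')) (R.X j) = 0 := by
      push_cast at r1 r2
      linear_combination (norm := module) r2 - r1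
    refine (smul_eq_zero.1 this).resolve_left ?_
    refine mul_ne_zero (by norm_num) ?_
    exact_mod_cast hi0
  have := R.HP (-(i - i')) i (R.H (i - i') (R.X j))
  rw [hPi, R.HH, hH0, map_zero, map_zero, map_zero, sub_zero,
    show -(i - i') + i = i' by ring] at this
  exact hP' this.symm

/-- If `X_j` is not a trivial weight vector, then either `G_i^+ X_j ≠ 0` for all `i` with
`a - j + i h_j ≠ 0`, or `G_{-i}^- X_j ≠ 0` for all these `i`. -/
theorem type_dichotomy {j : ℤ} (hX : R.X j ≠ 0) (hnt : ¬(R.h j = 0 ∧ R.a = j)) :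
    (∀ i : ℤ, R.a - j + i * R.h j ≠ 0 → R.P i (R.X j) ≠ 0) ∨
    (∀ i : ℤ, R.a - j + i * R.h j ≠ 0 → R.Q (-i) (R.X j) ≠ 0) := by
  have hexc := finite_exceptional hnt
  by_cases hm : {i : ℤ | R.a - j + i * R.h j ≠ 0 ∧ R.Q (-i) (R.X j) ≠ 0}.Finite
  · refine Or.inl fun i hi => P_ne_zero_of_finite hX ((hexc.union hm).subset fun l hl => ?_) hi
    by_cases he : R.a - j + l * R.h j = 0
    · exact Or.inl he
    · rcases P_or_Q hX he with h | h
      · exact absurd hl h.1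
      · exact Or.inr ⟨he, h.2.1⟩
  by_cases hp : {i : ℤ | R.a - j + i * R.h j ≠ 0 ∧ R.P i (R.X j) ≠ 0}.Finite
  · refine Or.inr fun i hi => P_ne_zero_of_finite (R := R.flip) hX
      (((hexc.union hp).preimage (f := fun m : ℤ => -m) neg_injective.injOn).subset
        fun l hl => ?_) (i' := -i) ?_
    · change R.Q l (R.X j) = 0 at hl
      by_cases he : R.a - j + ((-l : ℤ) : ℂ) * R.h j = 0
      · exact Or.inl he
      · rcases P_or_Q hX he with h | h
        · exact Or.inr ⟨he, h.1⟩
        · exact absurd hl (by simpa using h.2.1)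
    · change R.a - j + ((-i : ℤ) : ℂ) * -R.h j ≠ 0
      push_cast
      rwa [neg_mul_neg]
  · exact (not_infinite_infinite hX hnt hp hm).elim

/-! ### All even vectors have one `H_0`-weight and all odd vectors have the next one -/

/-- All even vectors have `H_0`-weight `w`, all odd ones have weight `w + 1`, and all positions are
occupied, except possibly position `a` on the side where the `H_0`-weight is zero. -/
structure Uniform (R : LineRep V) (w : ℂ) : Prop where
  hX : ∀ m, R.X m ≠ 0 → R.h m = w
  hY : ∀ n, R.Y n ≠ 0 → R.k n = w + 1
  X_ne : ∀ m : ℤ, ¬(w = 0 ∧ R.a = m) → R.X m ≠ 0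
  Y_ne : ∀ n : ℤ, ¬(w + 1 = 0 ∧ R.a = n) → R.Y n ≠ 0

/-- The vector `G_i^+ X_j` is a nonzero multiple of `Y_{i+j}`, which `G_{-i}^-` maps back. -/
theorem odd_of_type {j : ℤ} (hX : R.X j ≠ 0)
    (hT : ∀ i : ℤ, R.a - j + i * R.h j ≠ 0 → R.P i (R.X j) ≠ 0) {i : ℤ}
    (hi : R.a - j + i * R.h j ≠ 0) :
    R.Y (i + j) ≠ 0 ∧ R.k (i + j) = R.h j + 1 ∧ R.Q (-i) (R.Y (i + j)) ≠ 0 := by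
  obtain ⟨h1, h2⟩ := weight_of_P_ne (hT i hi)
  refine ⟨h1, h2, fun h0 => ?_⟩
  rcases P_or_Q hX hi with h | h
  · obtain ⟨r, hr⟩ := R.PX i j
    exact h.2.2 (by rw [hr, map_smul, h0, smul_zero])
  · exact hT i hi h.1

/-- If `X_j` is moved by the `G_i^+`, then `Y_n` is moved by the `G_i^-` and killed by the `G_i^+`, for
almost all `n` and `i`. -/
theorem odd_type {j : ℤ} (hX : R.X j ≠ 0)
    (hT : ∀ i : ℤ, R.a - j + i * R.h j ≠ 0 → R.P i (R.X j) ≠ 0) {n : ℤ}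
    (hi : R.a - j + (n - j) * R.h j ≠ 0) (hn : R.a ≠ n) (l : ℤ)
    (hl : R.a - n + l * (R.h j + 1) ≠ 0) :
    R.Q (-l) (R.Y n) ≠ 0 ∧ R.P l (R.Y n) = 0 := by
  obtain ⟨h1, h2, h3⟩ := odd_of_type hX hT (i := n - j) (by push_cast; exact hi)
  rw [sub_add_cancel] at h1 h2 h3
  have hi' : R.swap.a - n + ((n - j : ℤ) : ℂ) * R.swap.h n ≠ 0 := by
    change R.a - n + ((n - j : ℤ) : ℂ) * R.k n ≠ 0
    rw [h2]
    push_cast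
    intro h
    exact hi (by linear_combination h)
  have hl' : R.swap.a - n + l * R.swap.h n ≠ 0 := by
    change R.a - n + l * R.k n ≠ 0
    rwa [h2]
  rcases type_dichotomy (R := R.swap) (j := n) h1 (fun h => hn h.2) with hT' | hT'
  · rcases P_or_Q (R := R.swap) h1 hi' with h | h
    · exact absurd h.2.1 h3
    · exact absurd h.1 (hT' _ hi')
  · rcases P_or_Q (R := R.swap) h1 hl' with h | h
    · exact absurd h.2.1 (hT' _ hl')
    · exact ⟨h.2.1, h.1⟩

/-- If `X_j` is moved by the `G_i^+`, all even vectors have the weight of `X_j`: almost every `Y_n` is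
moved by the `G_i^-` and so reaches the even lines, while a nontrivial even vector of another weight
would send almost all odd lines to a wrong weight, or be reached by some `G_i^+` that kills `Y_n`. -/
theorem even_uniform {j : ℤ} (hX : R.X j ≠ 0) (hnt : ¬(R.h j = 0 ∧ R.a = j))
    (hT : ∀ i : ℤ, R.a - j + i * R.h j ≠ 0 → R.P i (R.X j) ≠ 0) :
    (∀ m, R.X m ≠ 0 → R.h m = R.h j) ∧
    (∀ m : ℤ, ¬(R.h j = 0 ∧ R.a = m) → R.X m ≠ 0) ∧
    ∃ n : ℤ, R.Y n ≠ 0 ∧ R.a ≠ n ∧ R.k n = R.h j + 1 ∧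
      ∀ l : ℤ, R.a - n + l * (R.h j + 1) ≠ 0 → R.Q (-l) (R.Y n) ≠ 0 := by
  -- the finitely many positions `n` in which `Y_n` is not controlled by `X_j`
  have f1 := finite_affine_zeros (u := R.a - j - j * R.h j) (v := R.h j) (by
    by_contra! hc
    refine hnt ⟨hc.2, ?_⟩
    linear_combination hc.1 + j * hc.2)
  have f2 := finite_affine_zeros (u := -R.a) (v := 1) (Or.inr one_ne_zero)
  have g1 : ∀ {n : ℤ}, ¬R.a - j - j * R.h j + n * R.h j = 0 → R.a - j + (n - j) * R.h j ≠ 0 :=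
    fun hn h => hn (by linear_combination h)
  have g2 : ∀ {n : ℤ}, ¬-R.a + (n : ℂ) * 1 = 0 → R.a ≠ n := fun hn h => hn (by rw [h]; ring)
  have hfull : ∀ m : ℤ, ¬(R.h j = 0 ∧ R.a = m) → R.X m ≠ 0 ∧ R.h m = R.h j := by
    intro m hm
    have f3 := finite_affine_zeros (u := R.a - m * (R.h j + 1)) (v := R.h j) (by
      by_contra! hc
      refine hm ⟨hc.2, ?_⟩
      linear_combination hc.1 + m * hc.2)
    obtain ⟨n, hn⟩ := ((f1.union f2).union f3).infinite_compl.nonempty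
    simp only [Set.mem_compl_iff, Set.mem_union, Set.mem_ofPred_eq, not_or] at hn
    obtain ⟨⟨n1, n2⟩, n3⟩ := hn
    obtain ⟨hQ, -⟩ := odd_type hX hT (g1 n1) (g2 n2) (n - m) (by
      push_cast
      intro h
      exact n3 (by linear_combination h))
    obtain ⟨e1, e2⟩ := weight_of_Q_ne (R := R.swap) hQ
    change R.X (-(n - m) + n) ≠ 0 at e1
    change R.h (-(n - m) + n) = R.k n - 1 at e2
    rw [show -(n - m) + n = m by ring] at e1 e2
    have e3 := (odd_of_type hX hT (i := n - j) (by push_cast; exact g1 n1)).2.1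
    rw [sub_add_cancel] at e3
    exact ⟨e1, by rw [e2, e3]; ring⟩
  refine ⟨fun m hm => ?_, fun m hm => (hfull m hm).1, ?_⟩
  · by_cases h0 : R.h j = 0
    swap
    · exact (hfull m fun h => h0 h.1).2
    by_cases htm : R.h m = 0 ∧ R.a = m
    · rw [htm.1, h0]
    have f4 := finite_affine_zeros (u := R.a - m - m * R.h m) (v := R.h m) (by
      by_contra! hc
      refine htm ⟨hc.2, ?_⟩
      linear_combination hc.1 + m * hc.2)
    have f5 := finite_affine_zeros (u := R.a - m + m * R.h m) (v := -R.h m) (by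
      by_contra! hc
      refine htm ⟨neg_eq_zero.1 hc.2, ?_⟩
      linear_combination hc.1 + m * hc.2)
    have f6 := finite_affine_zeros (u := R.a + m * (R.h j + 1)) (v := -(R.h j + 2)) (by
      refine Or.inr ?_
      rw [h0, zero_add]
      exact neg_ne_zero.2 two_ne_zero)
    obtain ⟨n, hn⟩ := ((((f1.union f2).union f4).union f5).union f6).infinite_compl.nonempty
    simp only [Set.mem_compl_iff, Set.mem_union, Set.mem_ofPred_eq, not_or] at hn
    obtain ⟨⟨⟨⟨n1, n2⟩, n4⟩, n5⟩, n6⟩ := hn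
    obtain ⟨-, e2, -⟩ := odd_of_type hX hT (i := n - j) (by push_cast; exact g1 n1)
    rw [sub_add_cancel] at e2
    rcases type_dichotomy hm htm with hT' | hT'
    · have := (weight_of_P_ne (hT' (n - m) (by
        push_cast
        intro h
        exact n4 (by linear_combination h)))).2
      rw [sub_add_cancel, e2] at this
      linear_combination -this
    · have he : R.a - m + ((m - n : ℤ) : ℂ) * R.h m ≠ 0 := by
        push_cast
        intro h
        exact n5 (by linear_combination h)
      rcases P_or_Q hm he with h | h
      · exact absurd h.2.1 (hT' _ he)
      · obtain ⟨r, hr⟩ := R.QX (-(m - n)) m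
        rw [show -(m - n) + m = n by ring] at hr
        have := (odd_type hX hT (g1 n1) (g2 n2) (m - n) (by
          push_cast
          intro h
          exact n6 (by linear_combination h))).2
        exact absurd (by rw [hr, map_smul, this, smul_zero]) h.2.2
  · obtain ⟨n, hn⟩ := (f1.union f2).infinite_compl.nonempty
    simp only [Set.mem_compl_iff, Set.mem_union, Set.mem_ofPred_eq, not_or] at hn
    obtain ⟨n1, n2⟩ := hn
    obtain ⟨e1, e2, -⟩ := odd_of_type hX hT (i := n - j) (by push_cast; exact g1 n1)
    rw [sub_add_cancel] at e1 e2
    exact ⟨n, e1, g2 n2, e2, fun l hl => (odd_type hX hT (g1 n1) (g2 n2) l hl).1⟩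

/-- The statement on odd vectors follows from the one on even vectors by exchanging the parities and
`G^±`. -/
theorem uniform_of_type {j : ℤ} (hX : R.X j ≠ 0) (hnt : ¬(R.h j = 0 ∧ R.a = j))
    (hT : ∀ i : ℤ, R.a - j + i * R.h j ≠ 0 → R.P i (R.X j) ≠ 0) : R.Uniform (R.h j) := by
  obtain ⟨hx, hx', n, hn, han, hkn, hQ⟩ := even_uniform hX hnt hT
  obtain ⟨hy, hy', -⟩ := even_uniform (R := R.swap.flip) (j := n) hn (fun h => han h.2) (by
    intro i hi
    change R.a - n + i * -R.k n ≠ 0 at hi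
    change R.Q i (R.Y n) ≠ 0
    have := hQ (-i) (by
      rw [← hkn]
      push_cast
      intro h
      exact hi (by linear_combination h))
    rwa [neg_neg] at this)
  refine ⟨hx, fun m hm => ?_, hx', fun m hm => hy' m fun h => hm ⟨?_, h.2⟩⟩
  · have := hy m hm
    change -R.k m = -R.k n at this
    rw [← hkn]
    exact neg_inj.1 this
  · have := h.1
    change -R.k n = 0 at this
    rw [← hkn]
    exact neg_eq_zero.1 this

theorem uniform_or_uniform_flip {j : ℤ} (hX : R.X j ≠ 0) (hnt : ¬(R.h j = 0 ∧ R.a = j)) :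
    (∃ w, R.Uniform w) ∨ ∃ w, R.flip.Uniform w := by
  rcases type_dichotomy hX hnt with h | h
  · exact Or.inl ⟨_, uniform_of_type hX hnt h⟩
  · refine Or.inr ⟨_, uniform_of_type (R := R.flip) (j := j) hX
      (fun h => hnt ⟨neg_eq_zero.1 h.1, h.2⟩) fun i hi => ?_⟩
    change R.a - j + i * -R.h j ≠ 0 at hi
    change R.Q i (R.X j) ≠ 0
    have := h (-i) (by
      push_cast
      intro h
      exact hi (by linear_combination h))
    rwa [neg_neg] at this

theorem Uniform.swap_flip {w : ℂ} (hU : R.Uniform w) : R.swap.flip.Uniform (-(w + 1)) where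
  hX m hm := neg_inj.2 (hU.hY m hm)
  hY m hm := by
    have := hU.hX m hm
    change -R.h m = _
    rw [this]
    ring
  X_ne m hm := hU.Y_ne m fun h => hm ⟨by rw [h.1, neg_zero], h.2⟩
  Y_ne m hm := hU.X_ne m fun h => hm ⟨by rw [h.1]; ring, h.2⟩

theorem Uniform.PY {w : ℂ} (hU : R.Uniform w) (i n : ℤ) : R.P i (R.Y n) = 0 := by
  by_contra h
  obtain ⟨e1, e2⟩ := weight_of_P_ne (R := R.swap) h
  change R.X (i + n) ≠ 0 at e1
  change R.h (i + n) = R.k n + 1 at e2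
  have hY : R.Y n ≠ 0 := fun h0 => h (by rw [h0, map_zero])
  rw [hU.hX _ e1, hU.hY _ hY] at e2
  exact two_ne_zero (α := ℂ) (by linear_combination -e2)

theorem Uniform.QX {w : ℂ} (hU : R.Uniform w) (i n : ℤ) : R.Q i (R.X n) = 0 :=
  hU.swap_flip.PY i n

end LineRep

/-! ### Coefficient functions with affine products -/

theorem coeffs_of_affine_mul_affine {A B A' B' x y v : ℂ}
    (h : ∀ n : ℤ, (A + n * B) * (A' + n * B') = (x + n * v) * (y + n * v)) :
    A * A' = x * y ∧ B * B' = v * v ∧ A * B' + A' * B = v * (x + y) := by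
  have h0 := h 0
  have h1 := h 1
  have h2 := h (-1)
  push_cast at h0 h1 h2
  refine ⟨by linear_combination h0, ?_, ?_⟩
  · linear_combination h1 / 2 + h2 / 2 - h0
  · linear_combination h1 / 2 - h2 / 2

/-- The eigenvalue of `{G_{j-n}^-, G_{n-j}^+}` on `X_j` when `X_j` has `H_0`-weight `w`. -/
def diagonal (a w : ℂ) (j n : ℤ) : ℂ := 2 * (a - j + (n - j) * w)

theorem diagonal_eq (a w : ℂ) (j n : ℤ) :
    diagonal a w j n = 2 * (a - j * (1 + w)) + n * (2 * w) := by
  unfold diagonal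
  ring

theorem eq_of_diagonal_eq_mul {a w c : ℂ} (hw : w ≠ 0) (hw1 : w + 1 ≠ 0) {j t : ℤ}
    (h : ∀ n, diagonal a w j n = c * diagonal a w t n) : j = t := by
  have h0 := h 0
  have h1 := h 1
  simp only [diagonal_eq] at h0 h1
  push_cast at h0 h1
  have hc : c = 1 := by
    have : (c - 1) * w = 0 := by linear_combination (h0 - h1) / 2
    exact sub_eq_zero.1 ((mul_eq_zero.1 this).resolve_right hw)
  subst hc
  have : ((j : ℂ) - t) * (w + 1) = 0 := by linear_combination -h0 / 2
  exact_mod_cast sub_eq_zero.1 ((mul_eq_zero.1 this).resolve_right hw1)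

/-- The data of two functions `p`, `q` such that `q t n * p n j` is affine in `n`, with prescribed
values for `t = j`. They arise from `G_{n-j}^+ X_j = p n j • Y_n` and `G_{t-n}^- Y_n = q t n • X_t`,
where `G_{t-n}^- G_{n-j}^+ = 2 L_{t-j} - (t + j - 2 n) H_{t-j}` on `X_j`. -/
structure AffinePair (a w : ℂ) (p q : ℤ → ℤ → ℂ) : Prop where
  affine : ∀ t j, ∃ A B : ℂ, ∀ n : ℤ, q t n * p n j = A + n * B
  diag : ∀ j n, q j n * p n j = diagonal a w j n

namespace AffinePair

variable {a w : ℂ} {p q : ℤ → ℤ → ℂ}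

theorem transpose (h : AffinePair a w p q) :
    AffinePair a w (fun n j => q j n) (fun t n => p n t) where
  affine t j := by
    obtain ⟨A, B, hAB⟩ := h.affine j t
    exact ⟨A, B, fun n => by rw [mul_comm, hAB]⟩
  diag j n := by rw [mul_comm, h.diag]

/-- The values `n` with `diagonal a w t n = 0` need the second product, as `diagonal a w j n` is then
nonzero. -/
theorem proportional (h : AffinePair a w p q) (hw1 : w + 1 ≠ 0) {t j : ℤ}
    (htj : t ≠ j) {c c' : ℂ} (hcc : c * c' = 1)
    (h1 : ∀ n, q t n * p n j = c * diagonal a w t n)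
    (h2 : ∀ n, q j n * p n t = c' * diagonal a w j n) (n : ℤ) :
    p n t ≠ 0 ∧ p n j = c * p n t := by
  have hc' : c' ≠ 0 := right_ne_zero_of_mul_eq_one hcc
  by_cases ht : diagonal a w t n = 0
  · have hj : diagonal a w j n ≠ 0 := by
      intro hj
      rw [diagonal_eq] at ht hj
      have : ((t : ℂ) - j) * (w + 1) = 0 := by linear_combination (hj - ht) / 2
      exact htj (by exact_mod_cast sub_eq_zero.1 ((mul_eq_zero.1 this).resolve_right hw1))
    have hd := h.diag j n
    rw [← hd] at hj
    have hpq : p n t = c' * p n j := by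
      refine mul_left_cancel₀ (left_ne_zero_of_mul hj) ?_
      rw [h2, ← hd]
      ring
    refine ⟨?_, ?_⟩
    · rw [hpq]
      exact mul_ne_zero hc' (right_ne_zero_of_mul hj)
    · rw [hpq, ← mul_assoc, hcc, one_mul]
  · have hd := h.diag t n
    rw [← hd] at ht
    refine ⟨right_ne_zero_of_mul ht, mul_left_cancel₀ (left_ne_zero_of_mul ht) ?_⟩
    rw [h1, ← hd]
    ring

/-- Comparing the factorisations of `(q t n * p n j) * (q j n * p n t)` into affine functions of `n`,
either the functions `p n j` and `p n t` of `n` are proportional, or so are `q t n` and `q j n`. -/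
theorem proportional_or (h : AffinePair a w p q) (hw : w ≠ 0) (hw1 : w + 1 ≠ 0) {t j : ℤ}
    (htj : t ≠ j) :
    (∃ c, c ≠ 0 ∧ ∀ n, p n t ≠ 0 ∧ p n j = c * p n t) ∨
    (∃ c, c ≠ 0 ∧ ∀ n, q t n ≠ 0 ∧ q j n = c * q t n) := by
  obtain ⟨A, B, hAB⟩ := h.affine t j
  obtain ⟨A', B', hAB'⟩ := h.affine j t
  obtain ⟨e1, e2, e3⟩ := coeffs_of_affine_mul_affine (A := A) (B := B) (A' := A') (B' := B')
    (x := 2 * (a - j * (1 + w))) (y := 2 * (a - t * (1 + w))) (v := 2 * w) (fun n => by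
      rw [← diagonal_eq, ← diagonal_eq, ← hAB, ← hAB', ← h.diag, ← h.diag]
      ring)
  have hB : B ≠ 0 := by
    rintro rfl
    rw [zero_mul] at e2
    exact hw (by simpa using e2.symm)
  have hcc : B / (2 * w) * (B' / (2 * w)) = 1 := by
    field_simp
    linear_combination e2
  -- the root of the first factor is a root of one of the factors on the right
  have hroot : (A * w - B * (a - t * (1 + w))) * (A * w - B * (a - j * (1 + w))) = 0 := by
    linear_combination -A ^ 2 * e2 / 4 + A * B * e3 / 4 - B ^ 2 * e1 / 4
  rcases mul_eq_zero.1 hroot with hr | hr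
  · refine Or.inl ⟨_, left_ne_zero_of_mul_eq_one hcc, h.proportional hw1 htj hcc
      (fun n => ?_) (fun n => ?_)⟩
    · rw [hAB, diagonal_eq]
      field_simp
      linear_combination hr
    · have hr' : A' * w = B' * (a - j * (1 + w)) := by
        refine mul_left_cancel₀ (mul_ne_zero hB hw) ?_
        linear_combination w ^ 2 * e3 - w * B' * hr - w * (a - t * (1 + w)) * e2
          - w * (a - j * (1 + w)) * e2
      rw [hAB', diagonal_eq]
      field_simp
      linear_combination hr'
  · refine Or.inr ⟨_, right_ne_zero_of_mul_eq_one hcc,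
      h.transpose.proportional hw1 htj (c' := B / (2 * w)) (by rw [mul_comm, hcc])
      (fun n => ?_) (fun n => ?_)⟩
    · have hr' : A' * w = B' * (a - t * (1 + w)) := by
        refine mul_left_cancel₀ (mul_ne_zero hB hw) ?_
        linear_combination w ^ 2 * e3 - w * B' * hr - w * (a - t * (1 + w)) * e2
          - w * (a - j * (1 + w)) * e2
      rw [mul_comm, hAB', diagonal_eq]
      field_simp
      linear_combination hr'
    · rw [mul_comm, hAB, diagonal_eq]
      field_simp
      linear_combination hr

/-- If `w` is neither `0` nor `-1`, one of the two functions has rank one. -/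
theorem rank_one (h : AffinePair a w p q) (hw : w ≠ 0) (hw1 : w + 1 ≠ 0) :
    (∃ s : ℤ → ℂ, (∀ j, s j ≠ 0) ∧ ∀ j n, p n 0 ≠ 0 ∧ p n j = s j * p n 0) ∨
    (∃ s : ℤ → ℂ, (∀ j, s j ≠ 0) ∧ ∀ j n, q 0 n ≠ 0 ∧ q j n = s j * q 0 n) := by
  have glue : ∀ f : ℤ → ℤ → ℂ,
      (∀ j, j ≠ 0 → ∃ c, c ≠ 0 ∧ ∀ n, f n 0 ≠ 0 ∧ f n j = c * f n 0) →
      ∃ s : ℤ → ℂ, (∀ j, s j ≠ 0) ∧ ∀ j n, f n 0 ≠ 0 ∧ f n j = s j * f n 0 := by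
    intro f hf
    have : ∀ j, ∃ c, c ≠ 0 ∧ ∀ n, f n 0 ≠ 0 ∧ f n j = c * f n 0 := by
      intro j
      by_cases hj : j = 0
      · subst hj
        obtain ⟨c, -, h1⟩ := hf 1 one_ne_zero
        exact ⟨1, one_ne_zero, fun n => ⟨(h1 n).1, by rw [one_mul]⟩⟩
      · exact hf j hj
    choose s hs hs' using this
    exact ⟨s, hs, hs'⟩
  by_cases hI : ∀ j, j ≠ 0 → ∃ c, c ≠ 0 ∧ ∀ n, p n 0 ≠ 0 ∧ p n j = c * p n 0
  · exact Or.inl (glue p hI)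
  · refine Or.inr (glue (fun n j => q j n) fun l hl => ?_)
    push Not at hI
    obtain ⟨j, hj, hIj⟩ := hI
    obtain ⟨c, hc, hq⟩ := (h.proportional_or hw hw1 hj.symm).resolve_left (by
      rintro ⟨c, hc, hcn⟩
      obtain ⟨n, hn⟩ := hIj c hc
      exact hn (hcn n).1 (hcn n).2)
    by_cases hlj : j = l
    · subst hlj
      exact ⟨c, hc, hq⟩
    -- otherwise `p` is proportional in `0` and `l`, but `q` is so in `0` and `j`
    refine (h.proportional_or hw hw1 hl.symm).resolve_left ?_
    rintro ⟨c', hc', hp⟩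
    rcases h.proportional_or hw hw1 hlj with ⟨c'', -, hr⟩ | ⟨c'', -, hr⟩
    · refine hj (eq_of_diagonal_eq_mul hw hw1 (a := a) (c := c * (c' / c'')) fun n => ?_)
      have hc'' : c'' ≠ 0 := by
        rintro rfl
        have h1 := (hp n).2
        rw [(hr n).2, zero_mul, eq_comm] at h1
        exact mul_ne_zero hc' (hp n).1 h1
      have h1 := (hr n).2
      rw [(hp n).2] at h1
      rw [← h.diag, ← h.diag, (hq n).2]
      field_simp
      linear_combination -q 0 n * h1
    · refine hl (eq_of_diagonal_eq_mul hw hw1 (a := a) (c := c'' * c * c') fun n => ?_)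
      rw [← h.diag, ← h.diag, (hr n).2, (hq n).2, (hp n).2]
      ring

end AffinePair

/-! ### Comparison with the listed modules -/

/-- The structure coefficients of the modules in the classification. -/
def IsListed (K : Coeffs) : Prop :=
  (∃ a b, K = RACoeffs a b) ∨ (∃ a b, K = RBCoeffs a b) ∨ (∃ α, K = RAlowerCoeffs α) ∨
    (∃ β, K = RAupperCoeffs β) ∨ (∃ α, K = RBlowerCoeffs α) ∨ (∃ β, K = RBupperCoeffs β)

namespace LineRep

variable {V : Type*} [AddCommGroup V] [Module ℂ V] {R : LineRep V}

/-- After a rescaling of the generators of the lines, the operators `G_i^±` act with the structure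
coefficients `K`. The new generators have to be nonzero only where the lines are. -/
def Matches (R : LineRep V) (K : Coeffs) : Prop :=
  ∃ s t : ℤ → ℂ, (∀ j, R.X j ≠ 0 → s j ≠ 0) ∧ (∀ j, R.Y j ≠ 0 → t j ≠ 0) ∧
    (∀ i j, R.P i (s j • R.X j) = (K.Gpx i j * t (i + j)) • R.Y (i + j)) ∧
    (∀ i j, R.P i (t j • R.Y j) = (K.Gpy i j * s (i + j)) • R.X (i + j)) ∧
    (∀ i j, R.Q i (s j • R.X j) = (K.Gmx i j * t (i + j)) • R.Y (i + j)) ∧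
    (∀ i j, R.Q i (t j • R.Y j) = (K.Gmy i j * s (i + j)) • R.X (i + j))

/-- Up to parity, `R` matches one of the listed modules. -/
def Covered (R : LineRep V) : Prop := ∃ K, IsListed K ∧ (R.Matches K ∨ R.swap.Matches K)

theorem Covered.of_swap (h : R.swap.Covered) : R.Covered := by
  obtain ⟨K, hK, h | h⟩ := h
  · exact ⟨K, hK, Or.inr h⟩
  · exact ⟨K, hK, Or.inl h⟩

/-- The list is stable under `G_i^± ↦ G_i^∓`, up to the sign of the exceptional basis vector. -/
theorem Matches.of_flip {K : Coeffs} (hK : IsListed K) (h : R.flip.Matches K) :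
    ∃ K', IsListed K' ∧ R.Matches K' := by
  obtain ⟨s, t, hs, ht, h1, h2, h3, h4⟩ := h
  change ∀ i j, R.Q i (s j • R.X j) = (K.Gpx i j * t (i + j)) • R.Y (i + j) at h1
  change ∀ i j, R.Q i (t j • R.Y j) = (K.Gpy i j * s (i + j)) • R.X (i + j) at h2
  change ∀ i j, R.P i (s j • R.X j) = (K.Gmx i j * t (i + j)) • R.Y (i + j) at h3
  change ∀ i j, R.P i (t j • R.Y j) = (K.Gmy i j * s (i + j)) • R.X (i + j) at h4
  -- the coefficients after a change of sign of `s 0` or of `t 0`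
  set s' : ℤ → ℂ := fun j => if j = 0 then -s j else s j with hs'
  set t' : ℤ → ℂ := fun j => if j = 0 then -t j else t j with ht'
  have es : ∀ j, R.X j ≠ 0 → s' j ≠ 0 := by
    intro j hj
    have := hs j hj
    simp only [hs']
    split_ifs <;> simpa
  have et : ∀ j, R.Y j ≠ 0 → t' j ≠ 0 := by
    intro j hj
    have := ht j hj
    simp only [ht']
    split_ifs <;> simpa
  have sX : ∀ j, s' j • R.X j = (if j = 0 then (-1 : ℂ) else 1) • s j • R.X j := by
    intro j
    simp only [hs']
    split_ifs <;> module
  have tY : ∀ j, t' j • R.Y j = (if j = 0 then (-1 : ℂ) else 1) • t j • R.Y j := by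
    intro j
    simp only [ht']
    split_ifs <;> module
  rcases hK with ⟨a, b, rfl⟩ | ⟨a, b, rfl⟩ | ⟨α, rfl⟩ | ⟨β, rfl⟩ | ⟨α, rfl⟩ | ⟨β, rfl⟩
  · exact ⟨RBCoeffs a b, Or.inr (Or.inl ⟨a, b, rfl⟩), s, t, hs, ht, h3, h4, h1, h2⟩
  · exact ⟨RACoeffs a b, Or.inl ⟨a, b, rfl⟩, s, t, hs, ht, h3, h4, h1, h2⟩
  · refine ⟨RBlowerCoeffs α, Or.inr (Or.inr (Or.inr (Or.inr (Or.inl ⟨_, rfl⟩)))),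
      s', t, es, ht, fun i j => ?_,
      fun i j => ?_, fun i j => ?_, fun i j => ?_⟩
    · rw [sX, map_smul, h3]
      simp [RAlowerCoeffs, RBlowerCoeffs]
    · rw [h4]
      simp only [RAlowerCoeffs, RBlowerCoeffs, hs', ← Int.cast_add]
      split_ifs with h0 <;> simp [h0]
    · rw [sX, map_smul, h1]
      simp only [RAlowerCoeffs, RBlowerCoeffs]
      split_ifs <;> module
    · rw [h2]
      simp [RAlowerCoeffs, RBlowerCoeffs]
  · refine ⟨RBupperCoeffs β, Or.inr (Or.inr (Or.inr (Or.inr (Or.inr (⟨_, rfl⟩))))),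
      s, t', hs, et, fun i j => ?_,
      fun i j => ?_, fun i j => ?_, fun i j => ?_⟩
    · rw [h3]
      simp [RAupperCoeffs, RBupperCoeffs]
    · rw [tY, map_smul, h4]
      simp only [RAupperCoeffs, RBupperCoeffs]
      split_ifs with h0 <;> simp [h0]
    · rw [h1]
      simp only [RAupperCoeffs, RBupperCoeffs, ht']
      split_ifs <;> module
    · rw [tY, map_smul, h2]
      simp [RAupperCoeffs, RBupperCoeffs]
  · refine ⟨RAlowerCoeffs α, Or.inr (Or.inr (Or.inl ⟨_, rfl⟩)),
      s', t, es, ht, fun i j => ?_,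
      fun i j => ?_, fun i j => ?_, fun i j => ?_⟩
    · rw [sX, map_smul, h3]
      simp only [RAlowerCoeffs, RBlowerCoeffs]
      split_ifs <;> module
    · rw [h4]
      simp [RAlowerCoeffs, RBlowerCoeffs]
    · rw [sX, map_smul, h1]
      simp [RAlowerCoeffs, RBlowerCoeffs]
    · rw [h2]
      simp only [RAlowerCoeffs, RBlowerCoeffs, hs', ← Int.cast_add]
      split_ifs with h0 <;> simp [h0]
  · refine ⟨RAupperCoeffs β, Or.inr (Or.inr (Or.inr (Or.inl ⟨_, rfl⟩))),
      s, t', hs, et, fun i j => ?_,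
      fun i j => ?_, fun i j => ?_, fun i j => ?_⟩
    · rw [h3]
      simp only [RAupperCoeffs, RBupperCoeffs, ht']
      split_ifs <;> module
    · rw [tY, map_smul, h4]
      simp [RAupperCoeffs, RBupperCoeffs]
    · rw [h1]
      simp [RAupperCoeffs, RBupperCoeffs]
    · rw [tY, map_smul, h2]
      simp only [RAupperCoeffs, RBupperCoeffs]
      split_ifs with h0 <;> simp [h0]

theorem Covered.of_flip (h : R.flip.Covered) : R.Covered := by
  obtain ⟨K, hK, h | h⟩ := h
  · obtain ⟨K', hK', h'⟩ := h.of_flip hK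
    exact ⟨K', hK', Or.inl h'⟩
  · obtain ⟨K', hK', h'⟩ := Matches.of_flip (R := R.swap) hK h
    exact ⟨K', hK', Or.inr h'⟩

/-- The line `ℂ X_j` is a direct summand: it is killed by all `G_i^±`, and no `G_i^±` maps into it. -/
def Isolated (R : LineRep V) (j : ℤ) : Prop :=
  (∀ i, R.P i (R.X j) = 0 ∧ R.Q i (R.X j) = 0) ∧
    ∀ i n, i + n = j → R.P i (R.Y n) = 0 ∧ R.Q i (R.Y n) = 0

/-- A nonzero line which is a direct summand is everything. -/
def ConnectedEven (R : LineRep V) : Prop :=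
  ∀ j, R.X j ≠ 0 → R.Isolated j → (∀ m, m ≠ j → R.X m = 0) ∧ ∀ n, R.Y n = 0

/-! ### The coefficients of a uniform module -/

theorem exists_coeffs (R : LineRep V) : ∃ p q : ℤ → ℤ → ℂ,
    (∀ i j, R.P i (R.X j) = p (i + j) j • R.Y (i + j)) ∧
    (∀ i n, R.Q i (R.Y n) = q (i + n) n • R.X (i + n)) := by
  choose p hp using R.PX
  choose q hq using R.QY
  exact ⟨fun n j => p (n - j) j, fun t n => q (t - n) n, fun i j => by simp [hp],
    fun i n => by simp [hq]⟩

section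

variable {w : ℂ} {p q : ℤ → ℤ → ℂ}

theorem Uniform.affine (hU : R.Uniform w)
    (hp : ∀ i j, R.P i (R.X j) = p (i + j) j • R.Y (i + j))
    (hq : ∀ i n, R.Q i (R.Y n) = q (i + n) n • R.X (i + n)) {t : ℤ} (ht : R.X t ≠ 0) (j : ℤ) :
    ∃ A B : ℂ, ∀ n : ℤ, q t n * p n j = A + n * B := by
  obtain ⟨l, hl⟩ := R.LX (t - j) j
  obtain ⟨e, he⟩ := R.HX (t - j) j
  rw [sub_add_cancel] at hl he
  refine ⟨2 * l - (t + j) * e, 2 * e, fun n => ?_⟩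
  have h := R.QP (t - n) (n - j) (R.X j)
  rw [hU.QX, map_zero, add_zero, hp, map_smul, sub_add_cancel, hq, sub_add_cancel,
    show t - n + (n - j) = t - j by ring, hl, he] at h
  refine smul_left_injective ℂ ht ?_
  push_cast at h
  change (q t n * p n j) • R.X t = _ • R.X t
  linear_combination (norm := module) h

theorem Uniform.diag (hU : R.Uniform w)
    (hp : ∀ i j, R.P i (R.X j) = p (i + j) j • R.Y (i + j))
    (hq : ∀ i n, R.Q i (R.Y n) = q (i + n) n • R.X (i + n)) {j : ℤ} (hj : R.X j ≠ 0) (n : ℤ) :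
    q j n * p n j = diagonal R.a w j n := by
  have h := R.QP (j - n) (n - j) (R.X j)
  rw [hU.QX, map_zero, add_zero, hp, map_smul, sub_add_cancel, hq, sub_add_cancel,
    show j - n + (n - j) = 0 by ring, R.L0X, R.H0X, hU.hX j hj] at h
  refine smul_left_injective ℂ hj ?_
  push_cast at h
  change (q j n * p n j) • R.X j = _ • R.X j
  rw [diagonal]
  linear_combination (norm := module) h

/-- Structure coefficients where `G^+` maps even to odd vectors. -/
theorem Uniform.matches_of (hU : R.Uniform w)
    (hp : ∀ i j, R.P i (R.X j) = p (i + j) j • R.Y (i + j))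
    (hq : ∀ i n, R.Q i (R.Y n) = q (i + n) n • R.X (i + n)) {K : Coeffs}
    (hpy : ∀ i j, K.Gpy i j = 0) (hmx : ∀ i j, K.Gmx i j = 0) {s t : ℤ → ℂ}
    (hs : ∀ j, R.X j ≠ 0 → s j ≠ 0) (ht : ∀ n, R.Y n ≠ 0 → t n ≠ 0)
    (hsp : ∀ i j, s j * p (i + j) j = K.Gpx i j * t (i + j))
    (htq : ∀ i n, R.X (i + n) ≠ 0 → t n * q (i + n) n = K.Gmy i n * s (i + n)) :
    R.Matches K := by
  refine ⟨s, t, hs, ht, fun i j => ?_, fun i j => ?_, fun i j => ?_, fun i j => ?_⟩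
  · rw [map_smul, hp, smul_smul, hsp]
  · rw [map_smul, hU.PY, hpy, zero_mul, zero_smul, smul_zero]
  · rw [map_smul, hU.QX, hmx, zero_mul, zero_smul, smul_zero]
  · by_cases h0 : R.X (i + j) = 0
    · rw [map_smul, hq, h0, smul_zero, smul_zero, smul_zero]
    · rw [map_smul, hq, smul_smul, htq _ _ h0]

/-- Structure coefficients where `G^-` maps even to odd vectors, compared after a reversal of parity. -/
theorem Uniform.swap_matches_of (hU : R.Uniform w)
    (hp : ∀ i j, R.P i (R.X j) = p (i + j) j • R.Y (i + j))
    (hq : ∀ i n, R.Q i (R.Y n) = q (i + n) n • R.X (i + n)) {K : Coeffs}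
    (hpx : ∀ i j, K.Gpx i j = 0) (hmy : ∀ i j, K.Gmy i j = 0) {s t : ℤ → ℂ}
    (hs : ∀ j, R.X j ≠ 0 → s j ≠ 0) (ht : ∀ n, R.Y n ≠ 0 → t n ≠ 0)
    (hsp : ∀ i j, s j * p (i + j) j = K.Gpy i j * t (i + j))
    (htq : ∀ i n, R.X (i + n) ≠ 0 → t n * q (i + n) n = K.Gmx i n * s (i + n)) :
    R.swap.Matches K := by
  refine ⟨t, s, ht, hs, fun i j => ?_, fun i j => ?_, fun i j => ?_, fun i j => ?_⟩
  · change R.P i (t j • R.Y j) = _ • R.X (i + j)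
    rw [map_smul, hU.PY, hpx, zero_mul, zero_smul, smul_zero]
  · change R.P i (s j • R.X j) = _ • R.Y (i + j)
    rw [map_smul, hp, smul_smul, hsp]
  · change R.Q i (t j • R.Y j) = _ • R.X (i + j)
    by_cases h0 : R.X (i + j) = 0
    · rw [map_smul, hq, h0, smul_zero, smul_zero, smul_zero]
    · rw [map_smul, hq, smul_smul, htq _ _ h0]
  · change R.Q i (s j • R.X j) = _ • R.Y (i + j)
    rw [map_smul, hU.QX, hmy, zero_mul, zero_smul, smul_zero]

end

theorem Uniform.covered_of_ne {w : ℂ} (hU : R.Uniform w) (hw : w ≠ 0) (hw1 : w + 1 ≠ 0) :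
    R.Covered := by
  obtain ⟨p, q, hp, hq⟩ := R.exists_coeffs
  have hX : ∀ j, R.X j ≠ 0 := fun j => hU.X_ne j fun h => hw h.1
  have hA : AffinePair R.a w p q :=
    ⟨fun t j => hU.affine hp hq (hX t) j, fun j n => hU.diag hp hq (hX j) n⟩
  rcases hA.rank_one hw hw1 with ⟨s, hs, hsp⟩ | ⟨s, hs, hsq⟩
  · refine ⟨RACoeffs R.a (-(w + 2) / 2), Or.inl ⟨_, _, rfl⟩, Or.inl
      (hU.matches_of hp hq (fun _ _ => rfl) (fun _ _ => rfl) (s := fun j => (s j)⁻¹)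
      (t := fun n => p n 0) (fun j _ => inv_ne_zero (hs j)) (fun n _ => (hsp 0 n).1)
      (fun i j => ?_) (fun i n _ => ?_))⟩
    · simp only [RACoeffs]
      rw [(hsp j _).2, inv_mul_cancel_left₀ (hs j), one_mul]
    · have h1 := hA.diag (i + n) n
      rw [(hsp (i + n) n).2, diagonal] at h1
      simp only [RACoeffs]
      rw [eq_mul_inv_iff_mul_eq₀ (hs _)]
      push_cast at h1
      linear_combination h1
  · refine ⟨RBCoeffs R.a ((w - 1) / 2), Or.inr (Or.inl ⟨_, _, rfl⟩), Or.inr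
      (hU.swap_matches_of hp hq (fun _ _ => rfl) (fun _ _ => rfl) (s := s)
      (t := fun n => (q 0 n)⁻¹) (fun j _ => hs j) (fun n _ => inv_ne_zero (hsq 0 n).1)
      (fun i j => ?_) (fun i n _ => ?_))⟩
    · have h1 := hA.diag j (i + j)
      rw [(hsq j _).2, diagonal] at h1
      simp only [RBCoeffs]
      rw [eq_mul_inv_iff_mul_eq₀ (hsq 0 _).1]
      push_cast at h1
      linear_combination h1
    · simp only [RBCoeffs]
      rw [one_mul, inv_mul_eq_iff_eq_mul₀ (hsq 0 n).1, (hsq (i + n) n).2, mul_comm]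

/-! ### The case of `H_0`-weight zero -/

theorem affine_mul_affine_eq_zero {A B A' B' : ℂ}
    (h : ∀ n : ℤ, (A + n * B) * (A' + n * B') = 0) : (A = 0 ∧ B = 0) ∨ (A' = 0 ∧ B' = 0) := by
  obtain ⟨e1, e2, e3⟩ := coeffs_of_affine_mul_affine (x := 0) (y := 0) (v := 0)
    (fun n => by rw [h n]; ring)
  simp only [mul_zero, zero_mul] at e1 e2 e3
  by_cases hA : A = 0
  · by_cases hB : B = 0
    · exact Or.inl ⟨hA, hB⟩
    · subst hA
      simp only [zero_mul, zero_add] at e3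
      exact Or.inr ⟨(mul_eq_zero.1 e3).resolve_right hB, (mul_eq_zero.1 e2).resolve_left hB⟩
  · have hA' := (mul_eq_zero.1 e1).resolve_left hA
    subst hA'
    rw [zero_mul, add_zero] at e3
    exact Or.inr ⟨rfl, (mul_eq_zero.1 e3).resolve_left hA⟩

/-- Away from position `a` the coefficients of a uniform module with even `H_0`-weight zero have rank
one. If the line in position `a` is present, it is either a trivial submodule or a trivial quotient,
and affine functions of the position describe how it is attached to the rest. -/
theorem Uniform.covered_zero (hU : R.Uniform 0) (hc : R.ConnectedEven) : R.Covered := by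
  obtain ⟨p, q, hp, hq⟩ := R.exists_coeffs
  have gX : ∀ j : ℤ, R.a ≠ j → R.X j ≠ 0 := fun j hj => hU.X_ne j fun h => hj h.2
  have gY : ∀ n, R.Y n ≠ 0 := fun n => hU.Y_ne n fun h => one_ne_zero (α := ℂ) (by simpa using h.1)
  have a1 : R.a ≠ (1 : ℤ) := fun h => one_ne_zero (R.int_a 1 h)
  have hd : ∀ {j : ℤ}, R.a ≠ j → ∀ n, q j n * p n j = 2 * (R.a - j) := by
    intro j hj n
    rw [hU.diag hp hq (gX j hj), diagonal]
    ring
  have hd0 : ∀ {j : ℤ}, R.a ≠ j → 2 * (R.a - j) ≠ 0 := fun hj =>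
    mul_ne_zero two_ne_zero (sub_ne_zero.2 hj)
  have hσ : ∀ n, p n 1 ≠ 0 := by
    intro n h0
    have := hd a1 n
    rw [h0, mul_zero] at this
    exact hd0 a1 this.symm
  have hrank : ∀ j : ℤ, ∃ s : ℂ, R.a ≠ j → s ≠ 0 ∧ ∀ n, s * p n j = p n 1 := by
    intro j
    by_cases hj : R.a = j
    · exact ⟨0, fun h => absurd hj h⟩
    obtain ⟨A, B, hAB⟩ := hU.affine hp hq (gX j hj) 1
    obtain ⟨A', B', hAB'⟩ := hU.affine hp hq (gX 1 a1) j
    obtain ⟨e1, e2, e3⟩ := coeffs_of_affine_mul_affine (A := A) (B := B) (A' := A') (B' := B')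
      (x := 2 * (R.a - j)) (y := 2 * (R.a - (1 : ℤ))) (v := 0) (fun n => by
        rw [← hAB, ← hAB', mul_zero, add_zero, add_zero, ← hd hj n, ← hd a1 n]
        ring)
    have hA : A ≠ 0 := left_ne_zero_of_mul (b := A') (by
      rw [e1]
      exact mul_ne_zero (hd0 hj) (hd0 a1))
    have hA' : A' ≠ 0 := right_ne_zero_of_mul (a := A) (by
      rw [e1]
      exact mul_ne_zero (hd0 hj) (hd0 a1))
    have hB : B = 0 := by
      rw [mul_zero] at e2
      rw [zero_mul] at e3
      rcases mul_eq_zero.1 e2 with h0 | h0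
      · exact h0
      · rw [h0, mul_zero, zero_add] at e3
        exact (mul_eq_zero.1 e3).resolve_left hA'
    refine ⟨A / (2 * (R.a - j)), fun _ => ⟨div_ne_zero hA (hd0 hj), fun n => ?_⟩⟩
    have h1 := hAB n
    have h2 := hd hj n
    rw [hB, mul_zero, add_zero] at h1
    rw [← h1, ← h2]
    have hqp : q j n * p n j ≠ 0 := by
      rw [h2]
      exact hd0 hj
    field_simp [left_ne_zero_of_mul hqp, right_ne_zero_of_mul hqp]
  choose s hs using hrank
  have hsq : ∀ {t : ℤ}, R.a ≠ t → ∀ n, p n 1 * q t n = 2 * (R.a - t) * s t := by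
    intro t ht n
    rw [← (hs t ht).2 n, ← hd ht n]
    ring
  by_cases ha : ∀ m : ℤ, R.a ≠ m
  · refine ⟨RACoeffs R.a (-1), Or.inl ⟨_, _, rfl⟩, Or.inl (hU.matches_of hp hq (fun _ _ => rfl)
      (fun _ _ => rfl) (s := s) (t := fun n => p n 1) (fun j _ => (hs j (ha j)).1)
      (fun n _ => hσ n) (fun i j => ?_) (fun i n _ => ?_))⟩
    · simp only [RACoeffs]
      rw [(hs j (ha j)).2, one_mul]
    · rw [hsq (ha _)]
      simp only [RACoeffs]
      push_cast
      ring
  push Not at ha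
  obtain ⟨m, hm⟩ := ha
  have hm0 := R.int_a m hm
  subst hm0
  have ha0 : R.a = 0 := by simpa using hm
  have hne : ∀ {j : ℤ}, j ≠ 0 → R.a ≠ j := by
    intro j hj h
    exact hj (R.int_a j h)
  -- if `X_0` spans a submodule, the even vectors are images under the `G_i^-`
  have sub_case : (∀ n, p n 0 = 0) → ∀ τ : ℂ, (R.X 0 ≠ 0 → τ ≠ 0) → ∀ K : Coeffs,
      (∀ i j, K.Gpx i j = 0) → (∀ i j, K.Gmy i j = 0) → (∀ i j, K.Gpy i j = -2 * j) →
      (∀ i j, i + j ≠ 0 → K.Gmx i j = 1) →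
      (∀ n, R.X 0 ≠ 0 → p n 1 * q 0 n = K.Gmx (-n) n * τ) → R.swap.Matches K := by
    intro hp0 τ hτ K k1 k2 k3 k4 hq0
    refine hU.swap_matches_of hp hq k1 k2 (s := fun j => if j = 0 then τ else -2 * j * s j)
      (t := fun n => p n 1) (fun j hj => ?_) (fun n _ => hσ n) (fun i j => ?_) (fun i n hX => ?_)
    · split_ifs with h0
      · subst h0
        exact hτ hj
      · exact mul_ne_zero (mul_ne_zero (by norm_num) (by exact_mod_cast h0)) (hs j (hne h0)).1
    · rw [k3]
      split_ifs with h0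
      · subst h0
        rw [hp0]
        simp
      · rw [mul_assoc, (hs j (hne h0)).2]
    · split_ifs with h0
      · obtain rfl : i = -n := by omega
        rw [neg_add_cancel] at hX ⊢
        exact hq0 n hX
      · rw [hsq (hne h0), k4 _ _ h0, ha0]
        ring
  by_cases hX0 : R.X 0 = 0
  · have hp0 : ∀ n, p n 0 = 0 := by
      intro n
      have := hp n 0
      rw [hX0, map_zero, add_zero, eq_comm] at this
      exact (smul_eq_zero.1 this).resolve_right (gY n)
    refine ⟨RBCoeffs 0 (-1 / 2), Or.inr (Or.inl ⟨_, _, rfl⟩), Or.inr (sub_case hp0 1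
      (fun _ => one_ne_zero) _ (fun _ _ => rfl) (fun _ _ => rfl) (fun i j => ?_)
      (fun _ _ _ => rfl) (fun n h => absurd hX0 h))⟩
    simp only [RBCoeffs]
    ring
  obtain ⟨A, B, hAB⟩ := hU.affine hp hq hX0 1
  obtain ⟨A', B', hAB'⟩ := hU.affine hp hq (gX 1 a1) 0
  have hp0 : ∀ n : ℤ, -2 * p n 0 = (A' + n * B') * p n 1 := by
    intro n
    have h1 := hd a1 n
    rw [ha0] at h1
    push_cast at h1
    rw [← hAB']
    linear_combination -p n 0 * h1
  have hprod : ∀ n : ℤ, (A + n * B) * (A' + n * B') = 0 := by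
    intro n
    have h1 := hU.diag hp hq hX0 n
    rw [diagonal, ha0] at h1
    rw [← hAB]
    push_cast at h1
    linear_combination -q 0 n * hp0 n - 2 * h1
  rcases affine_mul_affine_eq_zero hprod with ⟨rfl, rfl⟩ | ⟨rfl, rfl⟩
  · have hq0 : ∀ n, q 0 n = 0 := fun n =>
      (mul_eq_zero.1 (by simpa using hAB n)).resolve_right (hσ n)
    -- now `X_0` spans a quotient
    have quot_case : ∀ τ : ℂ, τ ≠ 0 → ∀ K : Coeffs, (∀ i j, K.Gpy i j = 0) →
        (∀ i j, K.Gmx i j = 0) → (∀ i j, K.Gmy i j = -2 * (i + j)) →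
        (∀ i j, j ≠ 0 → K.Gpx i j = 1) →
        (∀ n, τ * p n 0 = K.Gpx n 0 * p n 1) → R.Matches K := by
      intro τ hτ K k1 k2 k3 k4 hpτ
      refine hU.matches_of hp hq k1 k2 (s := fun j => if j = 0 then τ else s j)
        (t := fun n => p n 1) (fun j _ => ?_) (fun n _ => hσ n) (fun i j => ?_) (fun i n _ => ?_)
      · split_ifs with h0
        · exact hτ
        · exact (hs j (hne h0)).1
      · split_ifs with h0
        · subst h0
          rw [add_zero]
          exact hpτ i
        · rw [(hs j (hne h0)).2, k4 _ _ h0, one_mul]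
      · rw [k3]
        split_ifs with h0
        · rw [h0, hq0, ← Int.cast_add, h0]
          simp
        · rw [hsq (hne h0), ha0]
          push_cast
          ring
    by_cases hB : B' = 0
    · subst hB
      by_cases hA : A' = 0
      · -- `X_0` is a direct summand
        subst hA
        refine absurd ((hc 0 hX0 ⟨fun i => ⟨?_, hU.QX i 0⟩, fun i n hin => ⟨hU.PY i n, ?_⟩⟩).2 0)
          (gY 0)
        · have : p (i + 0) 0 = 0 := by simpa using hp0 (i + 0)
          rw [hp, this, zero_smul]
        · rw [hq, hin, hq0, zero_smul]
      · refine ⟨RACoeffs 0 (-1), Or.inl ⟨_, _, rfl⟩, Or.inl (quot_case (-2 / A')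
          (div_ne_zero (by norm_num) hA) _ (fun _ _ => rfl) (fun _ _ => rfl) (fun i j => ?_)
          (fun _ _ _ => rfl) fun n => ?_)⟩
        · simp only [RACoeffs]
          ring
        · simp only [RACoeffs]
          field_simp
          linear_combination hp0 n
    · refine ⟨RAlowerCoeffs (A' / B'), Or.inr (Or.inr (Or.inl ⟨_, rfl⟩)), Or.inl (quot_case (2 / B')
        (div_ne_zero two_ne_zero hB) _ (fun _ _ => rfl) (fun _ _ => rfl) (fun i j => rfl)
        (fun _ _ h => if_neg h) fun n => ?_)⟩
      simp only [RAlowerCoeffs, if_true]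
      field_simp
      linear_combination -hp0 n
  · have hp0' : ∀ n, p n 0 = 0 := fun n => by simpa using hp0 n
    by_cases hB : B = 0
    · subst hB
      by_cases hA : A = 0
      · subst hA
        have hq0 : ∀ n, q 0 n = 0 := fun n =>
          (mul_eq_zero.1 (by simpa using hAB n)).resolve_right (hσ n)
        refine absurd ((hc 0 hX0 ⟨fun i => ⟨?_, hU.QX i 0⟩, fun i n hin => ⟨hU.PY i n, ?_⟩⟩).2 0)
          (gY 0)
        · rw [hp, hp0', zero_smul]
        · rw [hq, hin, hq0, zero_smul]
      · refine ⟨RBCoeffs 0 (-1 / 2), Or.inr (Or.inl ⟨_, _, rfl⟩), Or.inr (sub_case hp0' A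
          (fun _ => hA) _ (fun _ _ => rfl) (fun _ _ => rfl) (fun i j => ?_)
          (fun _ _ _ => rfl) (fun n _ => ?_))⟩
        · simp only [RBCoeffs]
          ring
        · simp only [RBCoeffs]
          linear_combination hAB n
    · refine ⟨RBupperCoeffs (-A / B),
        Or.inr (Or.inr (Or.inr (Or.inr (Or.inr ⟨_, rfl⟩)))), Or.inr (sub_case hp0' B
        (fun _ => hB) _ (fun _ _ => rfl) (fun _ _ => rfl) (fun i j => rfl)
        (fun _ _ h => if_neg h) (fun n _ => ?_))⟩
      simp only [RBupperCoeffs, neg_add_cancel, if_true]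
      push_cast
      field_simp
      linear_combination hAB n

/-! ### The classification in terms of lines -/

theorem Uniform.covered {w : ℂ} (hU : R.Uniform w) (hX : R.ConnectedEven)
    (hY : R.swap.ConnectedEven) : R.Covered := by
  by_cases hw : w = 0
  · subst hw
    exact hU.covered_zero hX
  by_cases hw1 : w + 1 = 0
  · have hU' := hU.swap_flip
    rw [hw1, neg_zero] at hU'
    refine Covered.of_swap (Covered.of_flip (hU'.covered_zero fun j hj hiso => ?_))
    exact hY j hj ⟨fun i => (hiso.1 i).symm, fun i n hin => (hiso.2 i n hin).symm⟩
  · exact hU.covered_of_ne hw hw1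

theorem covered_of_nontrivial {j : ℤ} (hj : R.X j ≠ 0) (hnt : ¬(R.h j = 0 ∧ R.a = j))
    (hX : R.ConnectedEven) (hY : R.swap.ConnectedEven) : R.Covered := by
  rcases uniform_or_uniform_flip hj hnt with ⟨w, hU⟩ | ⟨w, hU⟩
  · exact hU.covered hX hY
  · refine Covered.of_flip (hU.covered (fun j hj hiso => hX j hj ?_) fun j hj hiso => hY j hj ?_)
    · exact ⟨fun i => (hiso.1 i).symm, fun i n hin => (hiso.2 i n hin).symm⟩
    · exact ⟨fun i => (hiso.1 i).symm, fun i n hin => (hiso.2 i n hin).symm⟩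

/-- If all weights are trivial, the odd operators vanish, and the module is a trivial line, which is
the quotient of `RA_{0,-1}` spanned by the image of `x_0`. -/
theorem covered_of_trivial (hX : ∀ m, R.X m ≠ 0 → R.h m = 0 ∧ R.a = m)
    (hY : ∀ n, R.Y n ≠ 0 → R.k n = 0 ∧ R.a = n) {j : ℤ} (hj : R.X j ≠ 0)
    (hc : R.ConnectedEven) : R.Covered := by
  have hj0 := R.int_a j (hX j hj).2
  subst hj0
  have hPX : ∀ i m, R.P i (R.X m) = 0 := by
    intro i m
    by_contra h
    obtain ⟨e1, e2⟩ := weight_of_P_ne h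
    rw [(hY _ e1).1, (hX m fun h0 => h (by rw [h0, map_zero])).1] at e2
    exact one_ne_zero (α := ℂ) (by linear_combination -e2)
  have hQX : ∀ i m, R.Q i (R.X m) = 0 := by
    intro i m
    by_contra h
    obtain ⟨e1, e2⟩ := weight_of_Q_ne h
    rw [(hY _ e1).1, (hX m fun h0 => h (by rw [h0, map_zero])).1] at e2
    exact one_ne_zero (α := ℂ) (by linear_combination e2)
  have hPY : ∀ i m, R.P i (R.Y m) = 0 := by
    intro i m
    by_contra h
    obtain ⟨e1, e2⟩ := weight_of_P_ne (R := R.swap) h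
    change R.h (i + m) = R.k m + 1 at e2
    rw [(hX _ e1).1, (hY m fun h0 => h (by rw [h0, map_zero])).1] at e2
    exact one_ne_zero (α := ℂ) (by linear_combination -e2)
  have hQY : ∀ i m, R.Q i (R.Y m) = 0 := by
    intro i m
    by_contra h
    obtain ⟨e1, e2⟩ := weight_of_Q_ne (R := R.swap) h
    change R.h (i + m) = R.k m - 1 at e2
    rw [(hX _ e1).1, (hY m fun h0 => h (by rw [h0, map_zero])).1] at e2
    exact one_ne_zero (α := ℂ) (by linear_combination e2)
  obtain ⟨hX0, hY0⟩ := hc 0 hj ⟨fun i => ⟨hPX i 0, hQX i 0⟩, fun i n _ => ⟨hPY i n, hQY i n⟩⟩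
  refine ⟨RACoeffs 0 (-1), Or.inl ⟨_, _, rfl⟩, Or.inl ⟨fun _ => 1, fun _ => 1,
    fun _ _ => one_ne_zero, fun _ _ => one_ne_zero, fun i m => ?_, fun i m => ?_, fun i m => ?_,
    fun i m => ?_⟩⟩
  · rw [map_smul, hPX, hY0, smul_zero, smul_zero]
  · rw [hY0, smul_zero, map_zero]
    simp [RACoeffs]
  · rw [map_smul, hQX, hY0, smul_zero, smul_zero]
  · rw [hY0, smul_zero, map_zero]
    by_cases h0 : i + m = 0
    · obtain rfl : i = -m := by omega
      simp only [RACoeffs]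
      push_cast
      rw [eq_comm, show (2 * (0 + -(m : ℂ) - m + 2 * -(m : ℂ) * -1) * 1 : ℂ) = 0 by ring, zero_smul]
    · rw [hX0 _ h0, smul_zero]

theorem covered (hne : ∃ j, R.X j ≠ 0 ∨ R.Y j ≠ 0) (hX : R.ConnectedEven)
    (hY : R.swap.ConnectedEven) : R.Covered := by
  by_cases h1 : ∀ m, R.X m ≠ 0 → R.h m = 0 ∧ R.a = m
  · by_cases h2 : ∀ n, R.Y n ≠ 0 → R.k n = 0 ∧ R.a = n
    · obtain ⟨j, hj | hj⟩ := hne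
      · exact covered_of_trivial h1 h2 hj hX
      · exact Covered.of_swap (covered_of_trivial (R := R.swap) h2 h1 hj hY)
    · push Not at h2
      obtain ⟨n, hn, hn'⟩ := h2
      exact Covered.of_swap (covered_of_nontrivial (R := R.swap) hn
        (fun h => hn' h.1 h.2) hY hX)
  · push Not at h1
    obtain ⟨n, hn, hn'⟩ := h1
    exact covered_of_nontrivial hn (fun h => hn' h.1 h.2) hX hY

end LineRep

/-! ### The central element acts by zero -/

/-- If the Heisenberg algebra acts through operators that permute lines, its central element acts by
zero. Otherwise let `f`, `g` be the scalars by which `H_1 H_{-1}` and `H_2 H_{-2}` act on a line. As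
`H_1^2 H_{-2}` and `H_2 H_{-1}^2` commute on a line, `g (2 f - d) = f (f + d)`, while `H_{±1}` keeps `g`
and changes `f` by `∓d`, so three different numbers `f` would be roots of one quadratic equation. -/
theorem heisenberg_central_eq_zero {V : Type*} [AddCommGroup V] [Module ℂ V]
    (A A' B B' : Module.End ℂ V) (d : ℂ) (X : ℤ → V)
    (hA : ∀ v, A (A' v) - A' (A v) = d • v) (hB : ∀ v, B (B' v) - B' (B v) = (2 * d) • v)
    (hAB : ∀ v, A (B v) = B (A v)) (hAB' : ∀ v, A (B' v) = B' (A v))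
    (hA'B : ∀ v, A' (B v) = B (A' v)) (hA'B' : ∀ v, A' (B' v) = B' (A' v))
    (lA : ∀ j, ∃ r : ℂ, A (X j) = r • X (1 + j)) (lA' : ∀ j, ∃ r : ℂ, A' (X j) = r • X (-1 + j))
    (lB : ∀ j, ∃ r : ℂ, B (X j) = r • X (2 + j)) (lB' : ∀ j, ∃ r : ℂ, B' (X j) = r • X (-2 + j))
    {j : ℤ} (hj : X j ≠ 0) : d = 0 := by
  by_contra hd
  have line : ∀ (M N : Module.End ℂ V) (m n : ℤ), (∀ j, ∃ r : ℂ, M (X j) = r • X (m + j)) →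
      (∀ j, ∃ r : ℂ, N (X j) = r • X (n + j)) → ∀ j, ∃ r : ℂ, M (N (X j)) = r • X (m + n + j) := by
    intro M N m n hM hN j
    obtain ⟨r, hr⟩ := hN j
    obtain ⟨s, hs⟩ := hM (n + j)
    exact ⟨r * s, by rw [hr, map_smul, hs, smul_smul, add_assoc]⟩
  have key : ∀ (j : ℤ) (v : V) (u f g : ℂ), v = u • X j → v ≠ 0 → A (A' v) = f • v →
      B (B' v) = g • v → g * (2 * f - d) = f * (f + d) := by
    intro j v u f g hvdef hv hf hg
    have comm : A (A (B' (B (A' (A' v))))) = B (A' (A' (A (A (B' v))))) := by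
      obtain ⟨r, hr⟩ := line (A * A) B' 2 (-2) (line A A 1 1 lA lA) lB' j
      obtain ⟨s, hs⟩ := line B (A' * A') 2 (-2) lB (line A' A' (-1) (-1) lA' lA') j
      norm_num at hr hs
      rw [hvdef]
      simp only [map_smul, hs, hr, smul_comm r s]
    have hf' : A' (A v) = (f - d) • v := by
      have := hA v
      rw [hf] at this
      linear_combination (norm := module) -this
    have hg' : B' (B v) = (g - 2 * d) • v := by
      have := hB v
      rw [hg] at this
      linear_combination (norm := module) -this
    have h1 : A (A (A' (A' v))) = (f * (f + d)) • v := by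
      have e1 := hA (A' v)
      rw [hf, map_smul] at e1
      have e2 : A (A' (A' v)) = (f + d) • A' v := by linear_combination (norm := module) e1
      rw [e2, map_smul, hf, smul_smul, mul_comm]
    have h2 : A' (A' (A (A v))) = ((f - d) * (f - 2 * d)) • v := by
      have e1 := hA (A v)
      rw [hf', map_smul] at e1
      have e2 : A' (A (A v)) = (f - 2 * d) • A v := by linear_combination (norm := module) -e1
      rw [e2, map_smul, hf', smul_smul, mul_comm]
    have e1 : A (A (B' (B (A' (A' v))))) = ((g - 2 * d) * (f * (f + d))) • v := by
      rw [← hA'B, ← hA'B, ← hA'B', ← hA'B', hg']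
      simp only [map_smul]
      rw [h1, smul_smul]
    have e2 : B (A' (A' (A (A (B' v))))) = (g * ((f - d) * (f - 2 * d))) • v := by
      rw [hAB', hAB', hA'B', hA'B', h2]
      simp only [map_smul]
      rw [hg, smul_smul, mul_comm]
    rw [e1, e2] at comm
    have := smul_left_injective ℂ hv comm
    refine mul_left_cancel₀ (mul_ne_zero two_ne_zero hd) ?_
    linear_combination this
  -- the vectors obtained from `v` by `A` and `A'` inherit the two eigenvalue equations
  have up : ∀ (v : V) (f g : ℂ), A (A' v) = f • v → B (B' v) = g • v →
      A (A' (A v)) = (f - d) • A v ∧ B (B' (A v)) = g • A v := by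
    intro v f g hf hg
    refine ⟨?_, by rw [← hAB', ← hAB, hg, map_smul]⟩
    have := congrArg A (hA v)
    rw [map_sub, hf, map_smul, map_smul] at this
    linear_combination (norm := module) -this
  have down : ∀ (v : V) (f g : ℂ), A (A' v) = f • v → B (B' v) = g • v →
      A (A' (A' v)) = (f + d) • A' v ∧ B (B' (A' v)) = g • A' v := by
    intro v f g hf hg
    refine ⟨?_, by rw [← hA'B', ← hA'B, hg, map_smul]⟩
    have := hA (A' v)
    rw [hf, map_smul] at this
    linear_combination (norm := module) this
  have two : ∀ (M : Module.End ℂ V) (m : ℤ), (∀ j, ∃ r : ℂ, M (X j) = r • X (m + j)) →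
      ∃ r : ℂ, M (M (X j)) = r • X (m + m + j) := fun M m hM => line M M m m hM hM j
  obtain ⟨f, hf⟩ := line A A' 1 (-1) lA lA' j
  obtain ⟨g, hg⟩ := line B B' 2 (-2) lB lB' j
  rw [add_neg_cancel, zero_add] at hf hg
  have k0 := key j _ 1 f g (one_smul ℂ _).symm hj hf hg
  by_cases hcase : f = d ∨ f = 2 * d
  · obtain ⟨f1, g1⟩ := down _ _ _ hf hg
    obtain ⟨f2, g2⟩ := down _ _ _ f1 g1
    have n1 : A' (X j) ≠ 0 := by
      intro h0
      rw [h0, map_zero] at hf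
      rcases smul_eq_zero.1 hf.symm with h | h
      · rcases hcase with h' | h' <;> · rw [h'] at h; simp [hd] at h
      · exact hj h
    have n2 : A' (A' (X j)) ≠ 0 := by
      intro h0
      rw [h0, map_zero] at f1
      rcases smul_eq_zero.1 f1.symm with h | h
      · rcases hcase with h' | h'
        · exact mul_ne_zero two_ne_zero hd (by linear_combination h - h')
        · exact mul_ne_zero three_ne_zero hd (by linear_combination h - h')
      · exact n1 h
    obtain ⟨r, hr⟩ := lA' j
    obtain ⟨s, hs⟩ := two A' (-1) lA'
    have k1 := key _ _ r _ _ hr n1 f1 g1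
    have k2 := key _ _ s _ _ hs n2 f2 g2
    refine mul_ne_zero hd hd ?_
    linear_combination (-k0 + 2 * k1 - k2) / 2
  · push Not at hcase
    obtain ⟨f1, g1⟩ := up _ _ _ hf hg
    obtain ⟨f2, g2⟩ := up _ _ _ f1 g1
    have n1 : A (X j) ≠ 0 := by
      intro h0
      have := hA (X j)
      rw [h0, map_zero, sub_zero, hf] at this
      exact hcase.1 (smul_left_injective ℂ hj this)
    have n2 : A (A (X j)) ≠ 0 := by
      intro h0
      have := hA (A (X j))
      rw [h0, map_zero, sub_zero, f1] at this
      have := smul_left_injective ℂ n1 this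
      exact hcase.2 (by linear_combination this)
    obtain ⟨r, hr⟩ := lA j
    obtain ⟨s, hs⟩ := two A 1 lA
    have k1 := key _ _ r _ _ hr n1 f1 g1
    have k2 := key _ _ s _ _ hs n2 f2 g2
    refine mul_ne_zero hd hd ?_
    linear_combination (-k0 + 2 * k1 - k2) / 2

/-! ### Consequences of indecomposability -/

theorem parity_eq (e : ZMod 2) : e = 0 ∨ e = 1 := by
  revert e
  decide

variable {V : Type*} [AddCommGroup V] [Module ℂ V] {M : algebra.SuperModule V}

theorem act_bracketBasis (M : algebra.SuperModule V) (x y : RamondBasis) :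
    M.act (bracketBasis x y) = M.act (single x 1) * M.act (single y 1) -
      koszulSign x.parity y.parity • (M.act (single y 1) * M.act (single x 1)) := by
  rw [← bracket_single]
  exact M.act_bracket (single_mem _ rfl _) (single_mem _ rfl _)

theorem act_single_mem (x : RamondBasis) {e : ZMod 2} {v : V} (hv : v ∈ M.part e) :
    M.act (single x 1) v ∈ M.part (x.parity + e) :=
  M.act_mem (single_mem _ rfl _) hv

/-- `S` contains the even and odd components of its elements. -/
def Graded (M : algebra.SuperModule V) (S : Submodule ℂ V) : Prop :=
  S ≤ (S ⊓ M.part 0) ⊔ (S ⊓ M.part 1)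

theorem Graded.isSubmodule {S : Submodule ℂ V} (hS : Graded M S)
    (h : ∀ (x : RamondBasis), ∀ v ∈ S, M.act (single x 1) v ∈ S) : M.IsSubmodule S := by
  refine ⟨fun x v hv => ?_, le_antisymm hS (sup_le inf_le_left inf_le_left)⟩
  induction x using Finsupp.induction_linear with
  | zero => simp
  | add f g hf hg =>
    rw [map_add]
    exact S.add_mem hf hg
  | single a b =>
    rw [← mul_one b, ← smul_eq_mul, ← Finsupp.smul_single, map_smul]
    exact S.smul_mem _ (h a v hv)

theorem Graded.iSup {ι : Sort*} {S : ι → Submodule ℂ V} (hS : ∀ i, Graded M (S i)) :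
    Graded M (⨆ i, S i) :=
  iSup_le fun i => (hS i).trans
    (sup_le_sup (inf_le_inf_right _ (le_iSup S i)) (inf_le_inf_right _ (le_iSup S i)))

theorem Graded.span {s : Set V} (hs : ∀ v ∈ s, ∃ e, v ∈ M.part e) :
    Graded M (Submodule.span ℂ s) := by
  refine Submodule.span_le.2 fun v hv => ?_
  obtain ⟨e, he⟩ := hs v hv
  have hv' := Submodule.subset_span (R := ℂ) hv
  rcases parity_eq e with rfl | rfl
  · exact Submodule.mem_sup_left ⟨hv', he⟩
  · exact Submodule.mem_sup_right ⟨hv', he⟩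

theorem eq_zero_of_mem_parts {e : ZMod 2} {v : V} (h0 : v ∈ M.part e) (h1 : v ∈ M.part (e + 1)) :
    v = 0 := by
  have hd := Submodule.disjoint_def.1 M.isCompl.disjoint
  rcases parity_eq e with rfl | rfl
  · exact hd v h0 h1
  · exact hd v h1 h0

theorem graded_eigenspace {x : RamondBasis} (hx : x.parity = 0) (μ : ℂ) :
    Graded M (Module.End.eigenspace (M.act (single x 1)) μ) := by
  intro v hv
  obtain ⟨v0, h0, v1, h1, rfl⟩ := Submodule.mem_sup.1
    (M.isCompl.sup_eq_top ▸ Submodule.mem_top : v ∈ M.part 0 ⊔ M.part 1)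
  have a0 := act_single_mem x h0
  have a1 := act_single_mem x h1
  rw [hx, zero_add] at a0 a1
  rw [Module.End.mem_eigenspace_iff, map_add, smul_add] at hv
  have hz : M.act (single x 1) v0 - μ • v0 = 0 := by
    refine eq_zero_of_mem_parts (e := 0) (Submodule.sub_mem _ a0 (Submodule.smul_mem _ _ h0)) ?_
    have : M.act (single x 1) v0 - μ • v0 = -(M.act (single x 1) v1 - μ • v1) := by
      linear_combination (norm := module) hv
    rw [this]
    exact Submodule.neg_mem _ (Submodule.sub_mem _ a1 (Submodule.smul_mem _ _ h1))
  have e0 := sub_eq_zero.1 hz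
  have e1 : M.act (single x 1) v1 = μ • v1 := by
    rw [e0] at hv
    exact add_left_cancel hv
  exact Submodule.add_mem_sup ⟨Module.End.mem_eigenspace_iff.2 e0, h0⟩
    ⟨Module.End.mem_eigenspace_iff.2 e1, h1⟩

theorem iSup_eigenspace_eq_top (hM : IsHarishChandra M) (x : RamondBasis)
    (hx : single x 1 ∈ cartan) : ⨆ μ, Module.End.eigenspace (M.act (single x 1)) μ = ⊤ := by
  classical
  have h := hM.1
  rw [eq_top_iff, ← DirectSum.IsInternal.submodule_iSup_eq_top h]
  exact iSup_le fun w => (iInf_le _ (⟨_, hx⟩ : cartan)).trans (le_iSup_of_le (w ⟨_, hx⟩) le_rfl)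

/-- If the basis elements of the algebra permute the `x`-eigenspaces with eigenvalues in `s` and those
with eigenvalues outside `s`, for an even basis element `x`, then all eigenvalues of `x` lie in `s`,
once one of them does. -/
theorem iSup_eigenspace_of_stable (hI : M.IsIndecomposable) (hM : IsHarishChandra M)
    {x : RamondBasis} (hx : single x 1 ∈ cartan) (hx0 : x.parity = 0) (s : Set ℂ)
    (hs : ∀ (y : RamondBasis) (μ : ℂ), ∃ ν, (μ ∈ s ↔ ν ∈ s) ∧
      ∀ v ∈ Module.End.eigenspace (M.act (single x 1)) μ,
        M.act (single y 1) v ∈ Module.End.eigenspace (M.act (single x 1)) ν)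
    {μ : ℂ} (hμ : μ ∈ s) (hne : Module.End.eigenspace (M.act (single x 1)) μ ≠ ⊥) :
    ⨆ μ ∈ s, Module.End.eigenspace (M.act (single x 1)) μ = ⊤ := by
  set E := Module.End.eigenspace (M.act (single x 1)) with hE
  have hsub : ∀ t : Set ℂ, (∀ (y : RamondBasis) (μ : ℂ), ∃ ν, (μ ∈ t ↔ ν ∈ t) ∧
      ∀ v ∈ E μ, M.act (single y 1) v ∈ E ν) → M.IsSubmodule (⨆ μ ∈ t, E μ) := by
    intro t ht
    refine (Graded.iSup fun μ => Graded.iSup fun _ => graded_eigenspace hx0 μ).isSubmodule ?_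
    intro y
    change _ ≤ (⨆ μ ∈ t, E μ).comap (M.act (single y 1))
    refine iSup₂_le fun μ hμ v hv => ?_
    obtain ⟨ν, hν, h⟩ := ht y μ
    exact Submodule.mem_iSup_of_mem ν (Submodule.mem_iSup_of_mem (hν.1 hμ) (h v hv))
  have hc : IsCompl (⨆ μ ∈ s, E μ) (⨆ μ ∈ sᶜ, E μ) := by
    refine ⟨(Module.End.eigenspaces_iSupIndep _).disjoint_biSup_biSup disjoint_compl_right, ?_⟩
    rw [codisjoint_iff, ← iSup_union, Set.union_compl_self, iSup_univ]
    exact iSup_eigenspace_eq_top hM x hx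
  rcases hI.2 _ _ (hsub s hs) (hsub sᶜ fun y μ => by
    obtain ⟨ν, h1, h2⟩ := hs y μ
    exact ⟨ν, not_congr h1, h2⟩) hc with h | h
  · exact absurd (eq_bot_iff.2 (h ▸ le_iSup₂_of_le μ hμ le_rfl)) hne
  · rw [h] at hc
    exact eq_top_of_isCompl_bot hc

theorem exists_eigenspace_ne_bot (hI : M.IsIndecomposable) (hM : IsHarishChandra M)
    {x : RamondBasis} (hx : single x 1 ∈ cartan) :
    ∃ μ, Module.End.eigenspace (M.act (single x 1)) μ ≠ ⊥ := by
  by_contra! h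
  have := iSup_eigenspace_eq_top hM x hx
  simp only [h, iSup_bot] at this
  have := hI.1
  exact bot_ne_top ‹(⊥ : Submodule ℂ V) = ⊤›

theorem C_mem_cartan : single RamondBasis.C 1 ∈ cartan :=
  Submodule.subset_span (by simp [C])

theorem L_mem_cartan : single (RamondBasis.L 0) 1 ∈ cartan :=
  Submodule.subset_span (by simp [L])

/-- The central element acts by a scalar. -/
theorem exists_central_charge (hI : M.IsIndecomposable) (hM : IsHarishChandra M) :
    ∃ z : ℂ, ∀ v, M.act C v = z • v := by
  obtain ⟨z, hz⟩ := exists_eigenspace_ne_bot hI hM C_mem_cartan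
  refine ⟨z, fun v => ?_⟩
  have := iSup_eigenspace_of_stable hI hM C_mem_cartan rfl {z} (fun y μ => ⟨μ, Iff.rfl, ?_⟩)
    (Set.mem_singleton z) hz
  · rw [iSup_singleton] at this
    exact Module.End.mem_eigenspace_iff.1 (this ▸ Submodule.mem_top)
  · intro v hv
    rw [Module.End.mem_eigenspace_iff] at hv ⊢
    have h := act_bracketBasis M y .C
    rw [bracketBasis_C, map_zero] at h
    have h01 : ¬ (0 : ZMod 2) = 1 := by decide
    have h := LinearMap.congr_fun h v
    simp only [koszulSign, RamondBasis.parity, h01, and_false, if_false, one_smul,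
      LinearMap.sub_apply, Module.End.mul_apply, LinearMap.zero_apply] at h
    rw [← sub_eq_zero.1 h.symm, hv, map_smul]

/-- The degree of a basis element, that is, minus its weight for the adjoint action of `L_0`. -/
def degree : RamondBasis → ℤ
  | .L i => i
  | .H i => i
  | .Gp i => i
  | .Gm i => i
  | .C => 0

theorem act_mem_eigenspace (y : RamondBasis) {μ : ℂ} {v : V}
    (hv : v ∈ Module.End.eigenspace (M.act (L 0)) μ) :
    M.act (single y 1) v ∈ Module.End.eigenspace (M.act (L 0)) (μ - degree y) := by
  rw [Module.End.mem_eigenspace_iff] at hv ⊢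
  have hb : bracketBasis (.L 0) y = (-(degree y : ℂ)) • single y 1 := by
    cases y <;> simp [bracketBasis, degree, L, H, Gp, Gm, δ]
  have h := LinearMap.congr_fun (act_bracketBasis M (.L 0) y) v
  have h01 : ¬ (0 : ZMod 2) = 1 := by decide
  rw [hb, map_smul] at h
  simp only [koszulSign, RamondBasis.parity, h01, false_and, if_false, one_smul,
      LinearMap.sub_apply, Module.End.mul_apply, LinearMap.smul_apply] at h
  change _ = M.act (L 0) _ - M.act _ (M.act (L 0) v) at h
  rw [hv, map_smul] at h
  linear_combination (norm := module) -h

/-- The eigenvalues of `L_0` form one coset of `ℤ`, with representative `0` if they are integers. -/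
theorem exists_base_weight (hI : M.IsIndecomposable) (hM : IsHarishChandra M) :
    ∃ a : ℂ, (∀ m : ℤ, a = m → m = 0) ∧
      ⨆ j : ℤ, Module.End.eigenspace (M.act (L 0)) (a - j) = ⊤ := by
  obtain ⟨μ, hμ⟩ := exists_eigenspace_ne_bot hI hM L_mem_cartan
  obtain ⟨a, ha, m, hm⟩ : ∃ a : ℂ, (∀ m : ℤ, a = m → m = 0) ∧ ∃ m : ℤ, μ = a - m := by
    by_cases h : ∃ m : ℤ, μ = m
    · obtain ⟨m, rfl⟩ := h
      exact ⟨0, fun m hm => by exact_mod_cast hm.symm, -m, by push_cast; ring⟩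
    · exact ⟨μ, fun m hm => absurd ⟨m, hm⟩ h, 0, by simp⟩
  refine ⟨a, ha, ?_⟩
  have := iSup_eigenspace_of_stable hI hM L_mem_cartan rfl (Set.range fun j : ℤ => a - (j : ℂ))
    (fun y μ => ⟨μ - degree y, ?_, fun v hv => act_mem_eigenspace y hv⟩) ⟨m, hm.symm⟩ hμ
  · rw [iSup_range] at this
    exact this
  · constructor
    · rintro ⟨j, rfl⟩
      exact ⟨j + degree y, by push_cast; ring⟩
    · rintro ⟨j, hj⟩
      exact ⟨j - degree y, by push_cast; linear_combination hj⟩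

/-! ### From modules to lines -/

theorem act_sub_act {x y : RamondBasis} (hx : x.parity = 0) (v : V) :
    M.act (single x 1) (M.act (single y 1) v) - M.act (single y 1) (M.act (single x 1) v) =
      M.act (bracketBasis x y) v := by
  have h01 : ¬ (0 : ZMod 2) = 1 := by decide
  simp [act_bracketBasis, koszulSign, hx, h01]

theorem act_add_act {x y : RamondBasis} (hx : x.parity = 1) (hy : y.parity = 1) (v : V) :
    M.act (single x 1) (M.act (single y 1) v) + M.act (single y 1) (M.act (single x 1) v) =
      M.act (bracketBasis x y) v := by
  simp [act_bracketBasis, koszulSign, hx, hy]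

/-- The lines and odd operators of `R` are those of the module `M` with trivial central element, where
the vectors `X_j` have parity `e` and the vectors `Y_j` have parity `e + 1`. -/
structure Realizes (R : LineRep V) (M : algebra.SuperModule V) (e : ZMod 2) : Prop where
  P_eq : ∀ i, R.P i = M.act (Gp i)
  Q_eq : ∀ i, R.Q i = M.act (Gm i)
  C_eq : M.act C = 0
  X_mem : ∀ j : ℤ, R.X j ∈ M.part e ⊓ Module.End.eigenspace (M.act (L 0)) (R.a - j)
  Y_mem : ∀ j : ℤ, R.Y j ∈ M.part (e + 1) ⊓ Module.End.eigenspace (M.act (L 0)) (R.a - j)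
  span : Submodule.span ℂ (Set.range R.X ∪ Set.range R.Y) = ⊤

theorem Realizes.swap {R : LineRep V} {e : ZMod 2} (h : Realizes R M e) :
    Realizes R.swap M (e + 1) where
  P_eq := h.P_eq
  Q_eq := h.Q_eq
  C_eq := h.C_eq
  X_mem := h.Y_mem
  Y_mem := by
    have : e + 1 + 1 = e := by
      rcases parity_eq e with rfl | rfl <;> rfl
    rw [this]
    exact h.X_mem
  span := by
    rw [Set.union_comm]
    exact h.span

theorem exists_line (h : ∀ (p : ZMod 2) (μ : ℂ),
      Module.rank ℂ ↥(M.part p ⊓ Module.End.eigenspace (M.act (L 0)) μ) ≤ 1) (a : ℂ) (e : ZMod 2) :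
    ∃ X : ℤ → V, ∀ j : ℤ, X j ∈ M.part e ⊓ Module.End.eigenspace (M.act (L 0)) (a - j) ∧
      ∀ v ∈ M.part e ⊓ Module.End.eigenspace (M.act (L 0)) (a - j), ∃ r : ℂ, v = r • X j := by
  have : ∀ j : ℤ, ∃ x : V, x ∈ M.part e ⊓ Module.End.eigenspace (M.act (L 0)) (a - j) ∧
      ∀ v ∈ M.part e ⊓ Module.End.eigenspace (M.act (L 0)) (a - j), ∃ r : ℂ, v = r • x := by
    intro j
    obtain ⟨x, hx, hs⟩ := (rank_submodule_le_one_iff _).1 (h e (a - j))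
    refine ⟨x, hx, fun v hv => ?_⟩
    obtain ⟨r, hr⟩ := Submodule.mem_span_singleton.1 (hs hv)
    exact ⟨r, hr.symm⟩
  exact Classical.skolem.1 this

theorem exists_ne_zero_of_span [Nontrivial V] {X Y : ℤ → V}
    (hspan : Submodule.span ℂ (Set.range X ∪ Set.range Y) = ⊤) : ∃ j, X j ≠ 0 ∨ Y j ≠ 0 := by
  by_contra! h
  refine bot_ne_top ((Submodule.span_eq_bot.2 ?_).symm.trans hspan)
  rintro _ (⟨j, rfl⟩ | ⟨j, rfl⟩)
  · exact (h j).1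
  · exact (h j).2

/-- A module of the intermediate series is described by lines: an `L_0`-eigenspace in a given parity is
at most one-dimensional and stable under `H_0`. -/
theorem exists_realizes (hM : IsIntermediateSeries M) : ∃ R : LineRep V, Realizes R M 0 := by
  obtain ⟨hI, hH, hr⟩ := hM
  obtain ⟨a, ha, htop⟩ := exists_base_weight hI hH
  obtain ⟨z, hz⟩ := exists_central_charge hI hH
  obtain ⟨X, hX⟩ := exists_line hr a 0
  obtain ⟨Y, hY⟩ := exists_line hr a 1
  have hspan : Submodule.span ℂ (Set.range X ∪ Set.range Y) = ⊤ := by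
    rw [eq_top_iff, ← htop]
    refine iSup_le fun j => (graded_eigenspace (M := M) (x := .L 0) rfl _).trans ?_
    refine sup_le (fun v hv => ?_) fun v hv => ?_
    · obtain ⟨r, rfl⟩ := (hX j).2 v hv.symm
      exact Submodule.smul_mem _ _ (Submodule.subset_span (Or.inl ⟨j, rfl⟩))
    · obtain ⟨r, rfl⟩ := (hY j).2 v hv.symm
      exact Submodule.smul_mem _ _ (Submodule.subset_span (Or.inr ⟨j, rfl⟩))
  have line : ∀ (e e' : ZMod 2) (y : RamondBasis) (S T : ℤ → V),
      (∀ j : ℤ, S j ∈ M.part e ⊓ Module.End.eigenspace (M.act (L 0)) (a - j)) →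
      (∀ j : ℤ, ∀ v ∈ M.part e' ⊓ Module.End.eigenspace (M.act (L 0)) (a - j),
        ∃ r : ℂ, v = r • T j) → y.parity + e = e' →
      ∀ j, ∃ r : ℂ, M.act (single y 1) (S j) = r • T (degree y + j) := by
    rintro e _ y S T hS hT rfl j
    refine hT _ _ ⟨act_single_mem y (hS j).1, ?_⟩
    have := act_mem_eigenspace y (hS j).2
    rwa [sub_sub, ← Int.cast_add, add_comm j] at this
  have h11 : (1 : ZMod 2) + 1 = 0 := rfl
  have lX := fun y hy => line 0 0 y X X (fun j => (hX j).1) (fun j => (hX j).2) hy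
  have lY := fun y hy => line 1 1 y Y Y (fun j => (hY j).1) (fun j => (hY j).2) hy
  have lXY := fun y hy => line 0 1 y X Y (fun j => (hX j).1) (fun j => (hY j).2) hy
  have lYX := fun y hy => line 1 0 y Y X (fun j => (hY j).1) (fun j => (hX j).2) hy
  have HH : ∀ i j v, M.act (H i) (M.act (H j) v) - M.act (H j) (M.act (H i) v) =
      ((1 / 3 : ℂ) * i * δ (i + j)) • z • v := by
    intro i j v
    have := act_sub_act (M := M) (x := .H i) (y := .H j) rfl v
    simp only [bracketBasis, map_smul, LinearMap.smul_apply, hz] at this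
    exact this
  have hz0 : z = 0 := by
    have hcomm : ∀ (i j : ℤ), i + j ≠ 0 → ∀ v,
        M.act (H i) (M.act (H j) v) = M.act (H j) (M.act (H i) v) := by
      intro i j hij v
      have := HH i j v
      simp only [δ, hij, if_false, mul_zero, zero_smul] at this
      exact sub_eq_zero.1 this
    have hc := fun (Z : ℤ → V) (hl : ∀ i : ℤ, ∀ j, ∃ r : ℂ, M.act (H i) (Z j) = r • Z (i + j)) j
        (hj : Z j ≠ 0) => heisenberg_central_eq_zero (M.act (H 1)) (M.act (H (-1)))
      (M.act (H 2)) (M.act (H (-2))) (z / 3) Z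
      (fun v => by rw [HH]; simp [δ, smul_smul]; ring_nf)
      (fun v => by rw [HH]; simp [δ, smul_smul]; ring_nf)
      (hcomm _ _ (by norm_num)) (hcomm _ _ (by norm_num)) (hcomm _ _ (by norm_num))
      (hcomm _ _ (by norm_num)) (hl 1) (hl (-1)) (hl 2) (hl (-2)) (j := j) hj
    have := hI.1
    obtain ⟨j, hj | hj⟩ := exists_ne_zero_of_span hspan
    · simpa using hc X (fun i => lX (.H i) rfl) j hj
    · simpa using hc Y (fun i => lY (.H i) rfl) j hj
  have hC : M.act C = 0 := LinearMap.ext fun v => by rw [hz, hz0, zero_smul, LinearMap.zero_apply]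
  have ev : ∀ {v : V} {e : ZMod 2} {j : ℤ},
      v ∈ M.part e ⊓ Module.End.eigenspace (M.act (L 0)) (a - j) → M.act (L 0) v = (a - j) • v :=
    fun h => Module.End.mem_eigenspace_iff.1 h.2
  have hX0 : ∀ j, ∃ r : ℂ, M.act (H 0) (X j) = r • X j := by
    intro j
    have := lX (.H 0) rfl j
    rwa [degree, zero_add] at this
  have hY0 : ∀ j, ∃ r : ℂ, M.act (H 0) (Y j) = r • Y j := by
    intro j
    have := lY (.H 0) rfl j
    rwa [degree, zero_add] at this
  choose h hh using hX0
  choose k hk using hY0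
  refine ⟨{ L := fun i => M.act (L i), H := fun i => M.act (H i), P := fun i => M.act (Gp i),
            Q := fun i => M.act (Gm i), X := X, Y := Y, a := a, h := h, k := k, int_a := ha,
            LX := fun i => lX (.L i) rfl, LY := fun i => lY (.L i) rfl,
            HX := fun i => lX (.H i) rfl, HY := fun i => lY (.H i) rfl,
            PX := fun i => lXY (.Gp i) rfl, PY := fun i => lYX (.Gp i) rfl,
            QX := fun i => lXY (.Gm i) rfl, QY := fun i => lYX (.Gm i) rfl,
            L0X := fun j => ev (hX j).1, L0Y := fun j => ev (hY j).1, H0X := hh, H0Y := hk,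
            LL := fun i j v => (act_sub_act (x := .L i) (y := .L j) rfl v).trans ?_,
            LH := fun i j v => (act_sub_act (x := .L i) (y := .H j) rfl v).trans ?_,
            HH := fun i j v => sub_eq_zero.1 ((HH i j v).trans ?_),
            HP := fun i j v => (act_sub_act (x := .H i) (y := .Gp j) rfl v).trans ?_,
            HQ := fun i j v => (act_sub_act (x := .H i) (y := .Gm j) rfl v).trans ?_,
            PP := fun i j v => (act_add_act (x := .Gp i) (y := .Gp j) rfl rfl v).trans ?_,
            QQ := fun i j v => (act_add_act (x := .Gm i) (y := .Gm j) rfl rfl v).trans ?_,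
            QP := fun i j v => (act_add_act (x := .Gm i) (y := .Gp j) rfl rfl v).trans ?_ },
    fun _ => rfl, fun _ => rfl, hC, fun j => (hX j).1, fun j => (hY j).1, hspan⟩
  all_goals simp [bracketBasis, hC, hz0]

/-! ### The odd part generates the algebra -/

theorem eq_top_of_odd {U : Submodule ℂ RamondSpace} (hP : ∀ i, Gp i ∈ U) (hQ : ∀ i, Gm i ∈ U)
    (hC : C ∈ U) (hb : ∀ i j, bracketBasis (.Gm i) (.Gp j) ∈ U) : U = ⊤ := by
  have hLH : ∀ n m : ℤ, (2 : ℂ) • L n - ((n : ℂ) + 2 * m) • H n ∈ U := by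
    intro n m
    have h := hb (n + m) (-m)
    simp only [bracketBasis, add_neg_cancel_right] at h
    have := U.sub_mem h (U.smul_mem ((1 / 3 : ℂ) * (((n + m : ℤ) : ℂ) ^ 2 - 1 / 4) * δ n) hC)
    rw [add_sub_cancel_right] at this
    convert this using 3
    push_cast
    ring
  have hH : ∀ n, H n ∈ U := by
    intro n
    have := U.smul_mem (1 / 2 : ℂ) (U.sub_mem (hLH n 0) (hLH n 1))
    convert this using 1
    push_cast
    module
  have hL : ∀ n, L n ∈ U := by
    intro n
    have := U.smul_mem (1 / 2 : ℂ) (U.add_mem (hLH n 0) (U.smul_mem (n : ℂ) (hH n)))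
    convert this using 1
    push_cast
    module
  rw [eq_top_iff]
  intro x _
  induction x using Finsupp.induction_linear with
  | zero => exact U.zero_mem
  | add f g hf hg => exact U.add_mem (hf trivial) (hg trivial)
  | single b r =>
    rw [← mul_one r, ← smul_eq_mul, ← Finsupp.smul_single]
    refine U.smul_mem _ ?_
    cases b with
    | L i => exact hL i
    | H i => exact hH i
    | Gp i => exact hP i
    | Gm i => exact hQ i
    | C => exact hC

theorem Graded.isSubmodule_of_odd {S : Submodule ℂ V} (hS : Graded M S) (hC : M.act C = 0)
    (hP : ∀ i, ∀ v ∈ S, M.act (Gp i) v ∈ S) (hQ : ∀ i, ∀ v ∈ S, M.act (Gm i) v ∈ S) :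
    M.IsSubmodule S := by
  let U : Submodule ℂ RamondSpace :=
    { carrier := {x | ∀ v ∈ S, M.act x v ∈ S}
      add_mem' := fun hx hy v hv => by
        rw [map_add]
        exact S.add_mem (hx v hv) (hy v hv)
      zero_mem' := fun v _ => by simp
      smul_mem' := fun r x hx v hv => by
        rw [map_smul]
        exact S.smul_mem r (hx v hv) }
  have hU : U = ⊤ := eq_top_of_odd hP hQ (fun v _ => by simp [hC]) fun i j v hv => by
    rw [← act_add_act rfl rfl]
    exact S.add_mem (hQ i _ (hP j v hv)) (hP j _ (hQ i v hv))
  exact hS.isSubmodule fun x => (hU ▸ Submodule.mem_top : single x 1 ∈ U)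

namespace Realizes

variable {R : LineRep V} {e : ZMod 2}

theorem connectedEven (h : Realizes R M e) (hI : M.IsIndecomposable) : R.ConnectedEven := by
  intro j hj hiso
  set B : Set V := R.X '' {j}ᶜ ∪ Set.range R.Y with hB
  have hom : ∀ v ∈ B, ∃ e, v ∈ M.part e := by
    rintro v (⟨m, -, rfl⟩ | ⟨n, rfl⟩)
    · exact ⟨_, (h.X_mem m).1⟩
    · exact ⟨_, (h.Y_mem n).1⟩
  have hY : ∀ (r : ℂ) n, r • R.Y n ∈ Submodule.span ℂ B := fun r n =>
    Submodule.smul_mem _ _ (Submodule.subset_span (Or.inr ⟨n, rfl⟩))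
  have hX : ∀ (r : ℂ) m, m ≠ j → r • R.X m ∈ Submodule.span ℂ B := fun r n hn =>
    Submodule.smul_mem _ _ (Submodule.subset_span (Or.inl ⟨n, hn, rfl⟩))
  have hS : M.IsSubmodule (Submodule.span ℂ {R.X j}) := by
    refine (Graded.span fun v hv => ⟨e, ?_⟩).isSubmodule_of_odd h.C_eq (fun i v hv => ?_)
      fun i v hv => ?_
    · rw [Set.mem_singleton_iff.1 hv]
      exact (h.X_mem j).1
    · obtain ⟨r, rfl⟩ := Submodule.mem_span_singleton.1 hv
      rw [map_smul, ← h.P_eq, (hiso.1 i).1, smul_zero]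
      exact Submodule.zero_mem _
    · obtain ⟨r, rfl⟩ := Submodule.mem_span_singleton.1 hv
      rw [map_smul, ← h.Q_eq, (hiso.1 i).2, smul_zero]
      exact Submodule.zero_mem _
  have hT : M.IsSubmodule (Submodule.span ℂ B) := by
    refine (Graded.span hom).isSubmodule_of_odd h.C_eq (fun i => ?_) fun i => ?_
    · change Submodule.span ℂ B ≤ (Submodule.span ℂ B).comap (M.act (Gp i))
      rw [Submodule.span_le, ← h.P_eq]
      rintro v (⟨m, -, rfl⟩ | ⟨n, rfl⟩)
      · obtain ⟨r, hr⟩ := R.PX i m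
        change R.P i (R.X m) ∈ Submodule.span ℂ B
        rw [hr]
        exact hY r _
      · obtain ⟨r, hr⟩ := R.PY i n
        change R.P i (R.Y n) ∈ Submodule.span ℂ B
        by_cases hin : i + n = j
        · rw [(hiso.2 i n hin).1]
          exact Submodule.zero_mem _
        · rw [hr]
          exact hX r _ hin
    · change Submodule.span ℂ B ≤ (Submodule.span ℂ B).comap (M.act (Gm i))
      rw [Submodule.span_le, ← h.Q_eq]
      rintro v (⟨m, -, rfl⟩ | ⟨n, rfl⟩)
      · obtain ⟨r, hr⟩ := R.QX i m
        change R.Q i (R.X m) ∈ Submodule.span ℂ B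
        rw [hr]
        exact hY r _
      · obtain ⟨r, hr⟩ := R.QY i n
        change R.Q i (R.Y n) ∈ Submodule.span ℂ B
        by_cases hin : i + n = j
        · rw [(hiso.2 i n hin).2]
          exact Submodule.zero_mem _
        · rw [hr]
          exact hX r _ hin
  have hc : IsCompl (Submodule.span ℂ {R.X j}) (Submodule.span ℂ B) := by
    refine ⟨Submodule.disjoint_def.2 fun v hv hv' => ?_, ?_⟩
    · -- by parity `v` is a combination of the `X_m`, `m ≠ j`, whose `L_0`-eigenvalues differ from
      -- that of `X_j`
      have hvX : v ∈ M.part e ⊓ Module.End.eigenspace (M.act (L 0)) (R.a - j) :=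
        (Submodule.span_le.2 (Set.singleton_subset_iff.2 (h.X_mem j))) hv
      rw [hB, Submodule.span_union] at hv'
      obtain ⟨u, hu, y, hy, rfl⟩ := Submodule.mem_sup.1 hv'
      have hu1 : u ∈ M.part e := by
        refine (Submodule.span_le.2 ?_ : Submodule.span ℂ (R.X '' {j}ᶜ) ≤ _) hu
        rintro _ ⟨m, -, rfl⟩
        exact (h.X_mem m).1
      have hy1 : y ∈ M.part (e + 1) := by
        refine (Submodule.span_le.2 ?_ : Submodule.span ℂ (Set.range R.Y) ≤ _) hy
        rintro _ ⟨m, rfl⟩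
        exact (h.Y_mem m).1
      have hy0 : y = 0 := by
        refine eq_zero_of_mem_parts ?_ hy1
        have := Submodule.sub_mem _ hvX.1 hu1
        rwa [add_sub_cancel_left] at this
      rw [hy0, add_zero] at hvX ⊢
      have hu2 : u ∈ ⨆ μ ≠ R.a - j, Module.End.eigenspace (M.act (L 0)) μ := by
        refine (Submodule.span_le.2 ?_ : Submodule.span ℂ (R.X '' {j}ᶜ) ≤ _) hu
        rintro _ ⟨m, hm, rfl⟩
        refine Submodule.mem_iSup_of_mem (R.a - m) (Submodule.mem_iSup_of_mem ?_ (h.X_mem m).2)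
        intro h'
        exact hm (by exact_mod_cast sub_right_injective h')
      exact Submodule.disjoint_def.1 (Module.End.eigenspaces_iSupIndep (M.act (L 0)) (R.a - j)) u
        hvX.2 hu2
    · rw [codisjoint_iff, ← Submodule.span_union, hB, ← Set.union_assoc, ← Set.image_singleton,
        ← Set.image_union, Set.union_compl_self, Set.image_univ]
      exact h.span
  rcases hI.2 _ _ hS hT hc with h0 | h0
  · exact absurd (Submodule.span_singleton_eq_bot.1 h0) hj
  · rw [Submodule.span_eq_bot] at h0
    exact ⟨fun m hm => h0 _ (Or.inl ⟨m, hm, rfl⟩), fun n => h0 _ (Or.inr ⟨n, rfl⟩)⟩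

/-- Matching structure coefficients of the `G_i^±` suffice for a homomorphism. -/
theorem isQuotientOf (h : Realizes R M e) {K : Coeffs} (hK : K.Relations) (hm : R.Matches K) :
    M.IsQuotientOf (K.toModule hK) := by
  obtain ⟨s, t, hs, ht, h1, h2, h3, h4⟩ := hm
  set f : XYSpace →ₗ[ℂ] V := linearCombination ℂ
    (Sum.elim (fun j => s j • R.X j) (fun j => t j • R.Y j)) with hf
  have fx : ∀ j, f (vx j) = s j • R.X j := fun j => by simp [hf, vx]
  have fy : ∀ j, f (vy j) = t j • R.Y j := fun j => by simp [hf, vy]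
  have act_eq : ∀ y, (K.toModule hK).act (single y 1) = K.op y := fun y => by
    change linearCombination ℂ K.op (single y 1) = _
    simp
  have ext : ∀ {g g' : XYSpace →ₗ[ℂ] V}, (∀ j, g (vx j) = g' (vx j)) →
      (∀ j, g (vy j) = g' (vy j)) → ∀ v, g v = g' v := by
    intro g g' hx hy
    refine LinearMap.congr_fun (Finsupp.lhom_ext' fun k => LinearMap.ext_ring ?_)
    rcases k with k | k
    · exact hx k
    · exact hy k
  let U : Submodule ℂ RamondSpace :=
    { carrier := {x | ∀ v, f ((K.toModule hK).act x v) = M.act x (f v)}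
      add_mem' := fun hx hy v => by
        simp only [map_add, LinearMap.add_apply]
        rw [hx v, hy v]
      zero_mem' := fun v => by simp
      smul_mem' := fun r x hx v => by
        simp only [map_smul, LinearMap.smul_apply]
        rw [hx v] }
  have hP : ∀ i, Gp i ∈ U := fun i =>
    ext (g := f ∘ₗ (K.toModule hK).act (single (.Gp i) 1)) (g' := M.act (Gp i) ∘ₗ f)
      (fun j => by
        rw [LinearMap.comp_apply, LinearMap.comp_apply, act_eq, Coeffs.op, Coeffs.ofValues_vx,
          map_smul, fy, fx, ← h.P_eq, h1, smul_smul])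
      (fun j => by
        rw [LinearMap.comp_apply, LinearMap.comp_apply, act_eq, Coeffs.op, Coeffs.ofValues_vy,
          map_smul, fx, fy, ← h.P_eq, h2, smul_smul])
  have hQ : ∀ i, Gm i ∈ U := fun i =>
    ext (g := f ∘ₗ (K.toModule hK).act (single (.Gm i) 1)) (g' := M.act (Gm i) ∘ₗ f)
      (fun j => by
        rw [LinearMap.comp_apply, LinearMap.comp_apply, act_eq, Coeffs.op, Coeffs.ofValues_vx,
          map_smul, fy, fx, ← h.Q_eq, h3, smul_smul])
      (fun j => by
        rw [LinearMap.comp_apply, LinearMap.comp_apply, act_eq, Coeffs.op, Coeffs.ofValues_vy,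
          map_smul, fx, fy, ← h.Q_eq, h4, smul_smul])
  have hU : U = ⊤ := by
    refine eq_top_of_odd hP hQ (fun v => ?_) fun i j v => ?_
    · rw [h.C_eq, C, act_eq, Coeffs.op]
      simp
    · rw [← act_add_act rfl rfl, ← act_add_act rfl rfl, map_add]
      exact congrArg₂ (· + ·) ((hQ i _).trans (congrArg _ (hP j v)))
        ((hP j _).trans (congrArg _ (hQ i v)))
  refine ⟨f, ?_, fun x => (hU ▸ Submodule.mem_top : x ∈ U), e, fun b v hv => ?_⟩
  · rw [← LinearMap.range_eq_top, eq_top_iff, ← h.span, Submodule.span_le]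
    rintro _ (⟨j, rfl⟩ | ⟨j, rfl⟩)
    · by_cases h0 : R.X j = 0
      · rw [h0]
        exact Submodule.zero_mem _
      · exact ⟨(s j)⁻¹ • vx j, by rw [map_smul, fx, inv_smul_smul₀ (hs j h0)]⟩
    · by_cases h0 : R.Y j = 0
      · rw [h0]
        exact Submodule.zero_mem _
      · exact ⟨(t j)⁻¹ • vy j, by rw [map_smul, fy, inv_smul_smul₀ (ht j h0)]⟩
  · refine mem_homogeneous (p := parityXY) (fun i hi => ?_) hv
    rcases i with i | i
    · obtain rfl : 0 = b := hi
      rw [zero_add]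
      exact (fx i) ▸ Submodule.smul_mem _ _ (h.X_mem i).1
    · obtain rfl : 1 = b := hi
      rw [add_comm]
      exact (fy i) ▸ Submodule.smul_mem _ _ (h.Y_mem i).1

end Realizes

end Ramond

end

theorem theorem1p2 {V : Type*} [AddCommGroup V] [Module ℂ V]
    (M : Ramond.algebra.SuperModule V) (hM : Ramond.IsIntermediateSeries M) :
    (∃ a b : ℂ, M.IsQuotientOf (Ramond.RA a b)) ∨
    (∃ a b : ℂ, M.IsQuotientOf (Ramond.RB a b)) ∨
    (∃ α : ℂ, M.IsQuotientOf (Ramond.RAlower α)) ∨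
    (∃ β : ℂ, M.IsQuotientOf (Ramond.RAupper β)) ∨
    (∃ α : ℂ, M.IsQuotientOf (Ramond.RBlower α)) ∨
    (∃ β : ℂ, M.IsQuotientOf (Ramond.RBupper β)) := by
  obtain ⟨R, hR⟩ := Ramond.exists_realizes hM
  have := hM.1.1
  obtain ⟨K, hK, hm⟩ := R.covered (Ramond.exists_ne_zero_of_span hR.span) (hR.connectedEven hM.1) (hR.swap.connectedEven hM.1)
  have key : ∀ hrel : K.Relations, M.IsQuotientOf (K.toModule hrel) := fun hrel =>
    hm.elim (hR.isQuotientOf hrel) (hR.swap.isQuotientOf hrel)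
  rcases hK with ⟨a, b, rfl⟩ | ⟨a, b, rfl⟩ | ⟨α, rfl⟩ | ⟨β, rfl⟩ | ⟨α, rfl⟩ | ⟨β, rfl⟩
  · exact Or.inl ⟨a, b, key _⟩
  · exact Or.inr (Or.inl ⟨a, b, key _⟩)
  · exact Or.inr (Or.inr (Or.inl ⟨α, key _⟩))
  · exact Or.inr (Or.inr (Or.inr (Or.inl ⟨β, key _⟩)))
  · exact Or.inr (Or.inr (Or.inr (Or.inr (Or.inl ⟨α, key _⟩))))
  · exact Or.inr (Or.inr (Or.inr (Or.inr (Or.inr ⟨β, key _⟩))))
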